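/- Let $\Sigma$ be a finite alphabet with at least two symbols and a fixed total order on them; $\Sigma^*$ is ordered length-lexicographically ($x<_{lex}y$ iff $|x|<|y|$, or $|x|=|y|$ and $x$ precedes $y$ lexicographically), and a natural number $n$ is identified with the string that has exactly $n$ strings strictly before it. A function is polynomial-time computable on a set $A$ if some deterministic Turing machine and polynomial $p$ are such that on each input $x\in A$ the machine outputs the value within $p(|x|)$ steps (nothing is required outside $A$). Let $L\subseteq\Sigma^*$ be exponentially dense: there is $c>0$ such that $L$ has at least $2^{\Omega(n^c)}$ strings of length $\le n$. Then: 1. If $L$ is strongly p-rankable, i.e. $x\mapsto|\{y\in L: y\le_{lex}x\}|$ is polynomial-time computable on $\Sigma^*$, then $L$ is p-scalable, i.e. there are a strongly p-rankable language $B\subseteq\Gamma^*$ ($\Gamma$ a finite totally ordered alphabet with at least two symbols) and a bijection $\Sigma^*\to\Gamma^*$ mapping $L$ onto $B$ that is polynomial-time computable and has a polynomial-time computable inverse. 2. If $L$ is p-scalable, then $L$ is p-countable, i.e. $L$ is finite or there are mutually inverse bijections $f\colon L\to\Sigma^*$ and $g\colon\Sigma^*\to L$ with $f$ polynomial-time computable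 on $L$ and $g$ polynomial-time computable on $\Sigma^*$. 3. If $L$ is p-countable, then there is a strict total order $\prec$ on $L$ such that: $\prec$ is length-related (for some polynomial $p$, $x\prec y$ implies $|x|\le p(|y|)$); $\prec$ is decidable in polynomial time on pairs of elements of $L$; and $L$ is weakly p-rankable with respect to $\prec$, i.e. for every $x\in L$ the set $\{y\in L: y\preceq x\}$ is finite and $x\mapsto|\{y\in L: y\preceq x\}|$ is polynomial-time computable on $L$. -/

import Mathlib

namespace PCard

/-! ### Polynomial-time computation -/

/-- `f` is computable in polynomial time on inputs from `A`: there are a deterministic multi-stack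
Turing machine (all of whose stack alphabets are finite) and a polynomial `p` such that on every
input `x ∈ A` the machine halts with output `f x` after at most `p (|x|)` steps. Nothing is
required on inputs outside `A`. For `A = Set.univ` this is membership in `FP`. -/
def PolyTimeOn {α β : Type} (A : Set (List α)) (f : List α → List β) : Prop :=
  ∃ (M : Turing.TM2ComputableAux α β) (p : Polynomial ℕ),
    (∀ k, Finite (M.tm.Γ k)) ∧
    ∀ x ∈ A, Nonempty (Turing.TM2OutputsInTime M.tm
      (x.map M.inputAlphabet.invFun)
      (some ((f x).map M.outputAlphabet.invFun))
      (p.eval x.length))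

/-- The pair `(x, y)` written as the string `x#y`, where `# = none` is a new separator symbol. -/
def pairStr {α : Type} (x y : List α) : List (Option α) :=
  x.map some ++ none :: y.map some

open Classical in
/-- The binary relation `R` on the language `L` is decidable in polynomial time on `L × L`:
some polynomial-time machine answers `true` or `false` correctly on all pairs from `L`. -/
def DecidablePolyTime {α : Type} (L : Language α)
    (R : {x // x ∈ L} → {x // x ∈ L} → Prop) : Prop :=
  ∃ d : List (Option α) → List Bool,
    PolyTimeOn {w | ∃ x ∈ L, ∃ y ∈ L, w = pairStr x y} d ∧
    ∀ x y : {x // x ∈ L}, d (pairStr x.1 y.1) = if R x y then [true] else [false]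

/-! ### Isomorphism, equipollence, countability -/

/-- `A` and `B` are p-isomorphic: some bijection `Σ* → Γ*` maps `A` onto `B` and is computable in
polynomial time together with its inverse. -/
def PIsomorphic {α β : Type} (A : Language α) (B : Language β) : Prop :=
  ∃ e : List α ≃ List β,
    PolyTimeOn Set.univ (e : List α → List β) ∧
    PolyTimeOn Set.univ (e.symm : List β → List α) ∧
    ∀ x, x ∈ A ↔ e x ∈ B

/-- `A` and `B` have the same p-cardinality: there are `f : A → B` and `g : B → A` that are inverse
to each other and computable in polynomial time on `A` and on `B` respectively. -/
def PEquipollent {α β : Type} (A : Language α) (B : Language β) : Prop :=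
  ∃ (f : List α → List β) (g : List β → List α),
    PolyTimeOn {x | x ∈ A} f ∧ PolyTimeOn {y | y ∈ B} g ∧
    (∀ x ∈ A, f x ∈ B) ∧ (∀ y ∈ B, g y ∈ A) ∧
    (∀ x ∈ A, g (f x) = x) ∧ (∀ y ∈ B, f (g y) = y)

/-- `L` is p-countable: it is finite or has the same p-cardinality as `Σ*`. -/
def PCountable {α : Type} (L : Language α) : Prop :=
  {x | x ∈ L}.Finite ∨ PEquipollent L (⊤ : Language α)

/-! ### Density -/

/-- The census function: the number of strings of length at most `n` in `L`. -/
noncomputable def census {α : Type} (L : Language α) (n : ℕ) : ℕ :=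
  {x | x ∈ L ∧ x.length ≤ n}.ncard

/-- `L` has at least `2 ^ Ω(n ^ c)` strings of length at most `n`, for some `c > 0`. -/
def ExponentiallyDense {α : Type} (L : Language α) : Prop :=
  ∃ c : ℝ, 0 < c ∧ ∃ a : ℝ, 0 < a ∧
    ∀ᶠ n : ℕ in Filter.atTop, (2 : ℝ) ^ (a * (n : ℝ) ^ c) ≤ (census L n : ℝ)

/-! ### Ranking -/

/-- Length-lexicographic order on strings: shorter strings first, strings of the same length
in lexicographic order. -/
def LexLT {α : Type} [LinearOrder α] (x y : List α) : Prop :=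
  List.Shortlex (· < ·) x y

/-- The natural number that a string stands for: the number of strings strictly before it in
length-lexicographic order, so that the empty string stands for `0`. Over a finite alphabet with
at least two symbols this is the usual bijection `Σ* → ℕ`. -/
noncomputable def numOfStr {α : Type} [LinearOrder α] (x : List α) : ℕ :=
  {y : List α | LexLT y x}.ncard

/-- The ranking function of `L` for length-lexicographic order. -/
noncomputable def rank {α : Type} [LinearOrder α] (L : Language α) (x : List α) : ℕ :=
  {y | y ∈ L ∧ (y = x ∨ LexLT y x)}.ncard

/-- The ranking function of `L` is in `FP`; its values are output as the strings that
stand for them. -/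
def StronglyPRankable {α : Type} [LinearOrder α] (L : Language α) : Prop :=
  ∃ r : List α → List α, PolyTimeOn Set.univ r ∧ ∀ x, numOfStr (r x) = rank L x

/-- `L` is p-isomorphic to a strongly p-rankable language, over some finite alphabet with at
least two symbols. -/
def PScalable {α : Type} (L : Language α) : Prop :=
  ∃ (β : Type) (_ : Fintype β) (_ : LinearOrder β) (_ : Nontrivial β) (B : Language β),
    StronglyPRankable B ∧ PIsomorphic L B

/-- The ranking function of `L` with respect to the strict order `R` on `L`, that is
`x ↦ |{y ∈ L : y = x or R y x}|`, takes finite values on `L` and is computable in polynomial time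
on inputs from `L`. -/
def WeaklyPRankableWrt {α : Type} [LinearOrder α] (L : Language α)
    (R : {x // x ∈ L} → {x // x ∈ L} → Prop) : Prop :=
  ∃ r : List α → List α, PolyTimeOn {x | x ∈ L} r ∧
    ∀ x : {x // x ∈ L},
      {y : {x // x ∈ L} | y = x ∨ R y x}.encard = (numOfStr (r x.1) : ℕ∞)

/-- `R x y` implies that `|x|` is at most a fixed polynomial in `|y|`. -/
def LengthRelated {α : Type} (L : Language α)
    (R : {x // x ∈ L} → {x // x ∈ L} → Prop) : Prop :=
  ∃ p : Polynomial ℕ, ∀ x y : {x // x ∈ L}, R x y → x.1.length ≤ p.eval y.1.length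

end PCard

/-! The first implication is witnessed by the identity. For the second, let `e` carry L onto a
language B with polynomial-time ranking function r. Then x ↦ r(e x) − 1 numbers the elements of L
from 0. Its inverse sends k to the preimage under `e` of the k-th element of B, and that element is
found by prefix search: a string w lies strictly before it iff r(w) ≤ k, so each comparison costs
one evaluation of r. The search is polynomial only if the element has polynomial length, and here
density enters. The number that a string of length m stands for is less than b^(m+1), L has at least
that many strings of length at most Q(m) (`ExponentiallyDense.exists_pow_le_census`), and `e`
lengthens strings only polynomially (`length_str_nth_le`).

For the third implication, density excludes a finite L, and the order of Σ* is pulled back along the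
bijection f from L to Σ*. Since f is onto, the rank of x is one more than the number of f x; since x
= g (f x), a smaller element is at most polynomially longer.

The bulk of the proof realises these algorithms on multi-stack machines. Programs are assembled from
pushes, case distinctions, loops and calls of given machines, and `polyTimeOn_of_wRuns` turns their
runs into statements about `PolyTimeOn`. Strings are treated as numerals in bijective base b (digits
1, …, b), for which length-lexicographic order is the order of values (`lexLT_iff_val_lt`). The
algorithms that carry the argument are `PolyTimeOn.comp`, `polyTimeOn_convert`, `polyTimeOn_pred`,
`polyTimeOn_pair` and, above all, `polyTimeOn_search`. -/

namespace PCard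

open Turing

/-! ### Structured programs for multi-stack machines -/

section Programs

set_option linter.unusedSectionVars false

variable {K : Type} [DecidableEq K] {Γ : K → Type} {τ : Type}

/-- The finite memory of a program: the result of the last pop, and further variables in `τ`. -/
abbrev Var (Γ : K → Type) (τ : Type) : Type := Option (Σ k, Γ k) × τ

/-- The machine `m` goes from `c` to `c'` in at most `t` steps. -/
def Reach {Λ σ : Type} (m : Λ → TM2.Stmt Γ Λ σ) (t : ℕ) (c c' : TM2.Cfg Γ Λ σ) : Prop :=
  ∃ n ≤ t, (flip bind (TM2.step m))^[n] (some c) = some c'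

theorem Reach.refl {Λ σ : Type} (m : Λ → TM2.Stmt Γ Λ σ) (c : TM2.Cfg Γ Λ σ) : Reach m 0 c c :=
  ⟨0, le_rfl, rfl⟩

theorem Reach.trans {Λ σ : Type} {m : Λ → TM2.Stmt Γ Λ σ} {t₁ t₂ : ℕ} {a b c : TM2.Cfg Γ Λ σ}
    (h₁ : Reach m t₁ a b) (h₂ : Reach m t₂ b c) : Reach m (t₁ + t₂) a c := by
  obtain ⟨n₁, hn₁, e₁⟩ := h₁
  obtain ⟨n₂, hn₂, e₂⟩ := h₂
  exact ⟨n₂ + n₁, by omega, by rw [Function.iterate_add_apply, e₁, e₂]⟩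

theorem Reach.mono {Λ σ : Type} {m : Λ → TM2.Stmt Γ Λ σ} {t₁ t₂ : ℕ} {a b : TM2.Cfg Γ Λ σ}
    (h : Reach m t₁ a b) (ht : t₁ ≤ t₂) : Reach m t₂ a b := by
  obtain ⟨n, hn, e⟩ := h
  exact ⟨n, hn.trans ht, e⟩

theorem Reach.single {Λ σ : Type} {m : Λ → TM2.Stmt Γ Λ σ} {a b : TM2.Cfg Γ Λ σ}
    (h : TM2.step m a = some b) : Reach m 1 a b :=
  ⟨1, le_rfl, by simpa [flip] using h⟩

/-- A program: a piece of machine code that is parametrized by the position of its labels in the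
label type of the whole machine, and by the label to jump to at the end. -/
structure Prog (Γ : K → Type) (τ : Type) where
  /-- the labels of the program -/
  Lab : Type
  /-- there are finitely many labels -/
  fin : Finite Lab
  /-- the label at which the program starts -/
  entry : Lab
  /-- the statements at the labels -/
  code : ∀ {Λ : Type}, (Lab → Λ) → Λ → Lab → TM2.Stmt Γ Λ (Var Γ τ)

/-- Started with stacks `S`, the program `P` ends with stacks `S'` after at most `t` steps. -/
def Prog.Runs (P : Prog Γ τ) (S S' : ∀ k, List (Γ k)) (t : ℕ) : Prop :=
  ∀ (Λ : Type) (m : Λ → TM2.Stmt Γ Λ (Var Γ τ)) (ren : P.Lab → Λ) (exit : Λ),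
    (∀ l, m (ren l) = P.code ren exit l) →
    ∀ v, ∃ v', Reach m t ⟨some (ren P.entry), v, S⟩ ⟨some exit, v', S'⟩

theorem Prog.Runs.mono {P : Prog Γ τ} {S S' : ∀ k, List (Γ k)} {t t' : ℕ}
    (h : P.Runs S S' t) (ht : t ≤ t') : P.Runs S S' t' := by
  intro Λ m ren exit hm v
  obtain ⟨v', h'⟩ := h Λ m ren exit hm v
  exact ⟨v', h'.mono ht⟩

theorem Prog.Runs.of_eq {P : Prog Γ τ} {S S' S'' : ∀ k, List (Γ k)} {t t' : ℕ}
    (h : P.Runs S S' t) (hS : S' = S'') (ht : t ≤ t') : P.Runs S S'' t' :=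
  hS ▸ h.mono ht

namespace Prog

/-- The program that does nothing. -/
def skip : Prog Γ τ where
  Lab := Unit
  fin := inferInstance
  entry := ()
  code _ exit _ := .goto fun _ => exit

theorem runs_skip (S : ∀ k, List (Γ k)) : (skip : Prog Γ τ).Runs S S 1 := by
  intro Λ m ren exit hm v
  exact ⟨v, .single (by rw [TM2.step, hm]; rfl)⟩

/-- Push the symbol `g` on the stack `k`. -/
def push (k : K) (g : Γ k) : Prog Γ τ where
  Lab := Unit
  fin := inferInstance
  entry := ()
  code _ exit _ := .push k (fun _ => g) (.goto fun _ => exit)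

theorem runs_push (k : K) (g : Γ k) (S : ∀ k, List (Γ k)) :
    (push k g : Prog Γ τ).Runs S (Function.update S k (g :: S k)) 1 := by
  intro Λ m ren exit hm v
  exact ⟨v, .single (by rw [TM2.step, hm]; rfl)⟩

/-- Run `P` and then `Q`. -/
def seq (P Q : Prog Γ τ) : Prog Γ τ where
  Lab := P.Lab ⊕ Q.Lab
  fin := by have := P.fin; have := Q.fin; infer_instance
  entry := .inl P.entry
  code ren exit
    | .inl l => P.code (ren ∘ .inl) (ren (.inr Q.entry)) l
    | .inr l => Q.code (ren ∘ .inr) exit l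

theorem Runs.seq {P Q : Prog Γ τ} {S S' S'' : ∀ k, List (Γ k)} {t t' : ℕ}
    (hP : P.Runs S S' t) (hQ : Q.Runs S' S'' t') : (P.seq Q).Runs S S'' (t + t') := by
  intro Λ m ren exit hm v
  obtain ⟨v', h⟩ := hP Λ m (ren ∘ .inl) (ren (.inr Q.entry)) (fun l => hm (.inl l)) v
  obtain ⟨v'', h'⟩ := hQ Λ m (ren ∘ .inr) exit (fun l => hm (.inr l)) v'
  exact ⟨v'', h.trans h'⟩

open Classical in
/-- Read off the symbol popped from the stack `k`. -/
noncomputable def popped (k : K) : Option (Σ k, Γ k) → Option (Γ k)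
  | none => none
  | some ⟨k', g⟩ => if h : k' = k then some (h ▸ g) else none

theorem popped_map (k : K) (o : Option (Γ k)) :
    popped k (o.map fun g => (⟨k, g⟩ : Σ k, Γ k)) = o := by
  cases o <;> simp [popped]

/-- Pop a symbol from the stack `k` and continue according to the result. -/
noncomputable def case [∀ k, Finite (Γ k)] (k : K) (P : Option (Γ k) → Prog Γ τ) : Prog Γ τ where
  Lab := Option (Σ o, (P o).Lab)
  fin := by have := fun o => (P o).fin; infer_instance
  entry := none
  code ren exit
    | none => .pop k (fun v o => (o.map fun g => ⟨k, g⟩, v.2))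
        (.goto fun v => ren (some ⟨popped k v.1, (P (popped k v.1)).entry⟩))
    | some ⟨o, l⟩ => (P o).code (fun l => ren (some ⟨o, l⟩)) exit l

theorem Runs.case [∀ k, Finite (Γ k)] {k : K} {P : Option (Γ k) → Prog Γ τ}
    {S S' : ∀ k, List (Γ k)} {t : ℕ}
    (h : (P (S k).head?).Runs (Function.update S k (S k).tail) S' t) :
    (case k P).Runs S S' (1 + t) := by
  intro Λ m ren exit hm v
  obtain ⟨v', h'⟩ := h Λ m (fun l => ren (some ⟨_, l⟩)) exit (fun l => hm (some ⟨_, l⟩))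
    ((S k).head?.map fun g => ⟨k, g⟩, v.2)
  refine ⟨v', .trans (.single ?_) h'⟩
  -- The type of the entry label depends on the popped symbol, so the two labels are identified by
  -- substituting the whole symbol at once.
  have e : ∀ o, o = (S k).head? → ren (some ⟨o, (P o).entry⟩) =
      ren (some ⟨(S k).head?, (P (S k).head?).entry⟩) := by
    rintro o rfl
    rfl
  rw [TM2.step, hm]
  simp only [Prog.case, TM2.stepAux]
  rw [e _ (popped_map k _)]

/-- As long as a symbol can be popped from the stack `k`, run the program for this symbol. -/
noncomputable def loop [∀ k, Finite (Γ k)] (k : K) (P : Γ k → Prog Γ τ) : Prog Γ τ where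
  Lab := Option (Σ g, (P g).Lab)
  fin := by have := fun g => (P g).fin; infer_instance
  entry := none
  code ren exit
    | none => .pop k (fun v o => (o.map fun g => ⟨k, g⟩, v.2))
        (.goto fun v => match popped k v.1 with
          | none => exit
          | some g => ren (some ⟨g, (P g).entry⟩))
    | some ⟨g, l⟩ => (P g).code (fun l => ren (some ⟨g, l⟩)) (ren none) l

theorem runs_loop_nil [∀ k, Finite (Γ k)] {k : K} {P : Γ k → Prog Γ τ}
    {S : ∀ k, List (Γ k)} (h : S k = []) : (loop k P).Runs S S 1 := by
  intro Λ m ren exit hm v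
  refine ⟨(none, v.2), .single ?_⟩
  have : Function.update S k [] = S := by rw [← h]; simp
  rw [TM2.step, hm]
  simp [Prog.loop, popped, h, this]

theorem Runs.loop_cons [∀ k, Finite (Γ k)] {k : K} {P : Γ k → Prog Γ τ}
    {S S' S'' : ∀ k, List (Γ k)} {t t' : ℕ} {g : Γ k} {l : List (Γ k)} (h : S k = g :: l)
    (hg : (P g).Runs (Function.update S k l) S' t) (hl : (loop k P).Runs S' S'' t') :
    (loop k P).Runs S S'' (1 + t + t') := by
  intro Λ m ren exit hm v
  obtain ⟨v', h'⟩ := hg Λ m (fun l => ren (some ⟨g, l⟩)) (ren none) (fun l => hm (some ⟨g, l⟩))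
    (some ⟨k, g⟩, v.2)
  obtain ⟨v'', h''⟩ := hl Λ m ren exit hm v'
  refine ⟨v'', .trans (.trans (.single ?_) h') h''⟩
  rw [TM2.step, hm]
  have := popped_map k (some g)
  simp only [Option.map_some] at this
  simp [Prog.loop, h, this]

/-- Empty the stack `k`; every symbol `g` from it is replaced by `φ g` and pushed on `k'`. -/
noncomputable def move [∀ k, Finite (Γ k)] (k k' : K) (φ : Γ k → Γ k') : Prog Γ τ :=
  loop k fun g => push k' (φ g)

/-- A move reverses the order. Working stacks therefore hold a string with its last letter, the
least significant digit, on top; this accounts for the reversals throughout. -/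
theorem runs_move [∀ k, Finite (Γ k)] {k k' : K} (hk : k ≠ k') (φ : Γ k → Γ k')
    (S : ∀ k, List (Γ k)) :
    (move k k' φ : Prog Γ τ).Runs S
      (Function.update (Function.update S k []) k' (((S k).map φ).reverse ++ S k'))
      (2 * (S k).length + 1) := by
  induction h : S k generalizing S with
  | nil =>
    have h1 : Function.update S k [] = S := by rw [← h]; simp
    have h2 : Function.update (Function.update S k []) k' ((([] : List (Γ k)).map φ).reverse ++ S k')
        = S := by simp [h1]
    rw [h2]
    exact runs_loop_nil h
  | cons g l ih =>
    have hp : (push k' (φ g) : Prog Γ τ).Runs (Function.update S k l)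
        (Function.update (Function.update S k l) k' (φ g :: S k')) 1 := by
      simpa [hk.symm] using runs_push (τ := τ) k' (φ g) (Function.update S k l)
    refine (Runs.loop_cons h hp (ih _ (by simp [hk]))).of_eq ?_ (by simp; omega)
    funext j
    by_cases h1 : j = k'
    · subst h1; simp
    · by_cases h2 : j = k
      · subst h2; simp [h1]
      · simp [h1, h2]

end Prog

/-! ### Machines as programs -/

/-- How a machine sits inside another one: an injection of its stacks and a part of the memory. -/
structure Embedding (tm : FinTM2) (Γ : K → Type) (τ : Type) where
  /-- the position of the stacks -/
  stack : tm.K → K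
  /-- different stacks have different positions -/
  inj : Function.Injective stack
  /-- the stack alphabets agree -/
  sym : ∀ k, tm.Γ k ≃ Γ (stack k)
  /-- read the memory of the machine -/
  get : τ → tm.σ
  /-- write the memory of the machine -/
  set : τ → tm.σ → τ
  /-- what has been written is read -/
  get_set : ∀ v s, get (set v s) = s

namespace Embedding

variable {tm : FinTM2} (E : Embedding tm Γ τ)

/-- The statement of the larger machine for a statement of the embedded one. -/
def stmt {Λ : Type} (ren : tm.Λ → Λ) (exit : Λ) :
    TM2.Stmt tm.Γ tm.Λ tm.σ → TM2.Stmt Γ Λ (Var Γ τ)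
  | .push k f q => .push (E.stack k) (fun v => E.sym k (f (E.get v.2))) (stmt ren exit q)
  | .peek k f q => .peek (E.stack k)
      (fun v o => (v.1, E.set v.2 (f (E.get v.2) (o.map (E.sym k).symm)))) (stmt ren exit q)
  | .pop k f q => .pop (E.stack k)
      (fun v o => (v.1, E.set v.2 (f (E.get v.2) (o.map (E.sym k).symm)))) (stmt ren exit q)
  | .load f q => .load (fun v => (v.1, E.set v.2 (f (E.get v.2)))) (stmt ren exit q)
  | .branch f q₁ q₂ => .branch (fun v => f (E.get v.2)) (stmt ren exit q₁) (stmt ren exit q₂)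
  | .goto f => .goto fun v => ren (f (E.get v.2))
  | .halt => .goto fun _ => exit

/-- The stacks `S`, except that those of the embedded machine are replaced by `T`. -/
noncomputable def put (S : ∀ k, List (Γ k)) (T : ∀ k, List (tm.Γ k)) : ∀ k, List (Γ k) := by
  classical
  exact fun k => if h : ∃ k₀, E.stack k₀ = k then h.choose_spec ▸ (T h.choose).map (E.sym _) else S k

theorem put_stack (S : ∀ k, List (Γ k)) (T : ∀ k, List (tm.Γ k)) (k : tm.K) :
    E.put S T (E.stack k) = (T k).map (E.sym k) := by
  have h : ∃ k₀, E.stack k₀ = E.stack k := ⟨k, rfl⟩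
  have key : ∀ k₀ (e : E.stack k₀ = E.stack k), e ▸ (T k₀).map (E.sym k₀) = (T k).map (E.sym k) := by
    intro k₀ e
    obtain rfl := E.inj e
    rfl
  simp only [put, dif_pos h]
  exact key _ _

theorem put_of_ne (S : ∀ k, List (Γ k)) (T : ∀ k, List (tm.Γ k)) {k : K}
    (h : ∀ k₀, E.stack k₀ ≠ k) : E.put S T k = S k := by
  simp [put, h]

theorem eq_put {S S' : ∀ k, List (Γ k)} {T : ∀ k, List (tm.Γ k)}
    (h₁ : ∀ k, S' (E.stack k) = (T k).map (E.sym k))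
    (h₂ : ∀ k, (∀ k₀, E.stack k₀ ≠ k) → S' k = S k) : S' = E.put S T := by
  funext k
  by_cases h : ∃ k₀, E.stack k₀ = k
  · obtain ⟨k₀, rfl⟩ := h
    rw [h₁, put_stack]
  · push Not at h
    rw [h₂ k h, put_of_ne _ _ _ h]

theorem update_put (S : ∀ k, List (Γ k)) (T : ∀ k, List (tm.Γ k)) (k : tm.K) (l : List (tm.Γ k)) :
    Function.update (E.put S T) (E.stack k) (l.map (E.sym k)) =
      E.put S (Function.update T k l) := by
  apply eq_put
  · intro k'
    by_cases h : k' = k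
    · subst h; simp
    · rw [Function.update_of_ne (fun e => h (E.inj e)), Function.update_of_ne h, put_stack]
  · intro k' h
    have h' := (h k).symm
    simp [h', put_of_ne _ _ _ h]

/-- One step of the embedded machine is one step of the large one. The label `none` of a halted
machine corresponds to the label `exit`, so halting becomes a jump to the continuation. -/
theorem stepAux_stmt {Λ : Type} (ren : tm.Λ → Λ) (exit : Λ) (S : ∀ k, List (Γ k))
    (q : TM2.Stmt tm.Γ tm.Λ tm.σ) (v : Var Γ τ) (T : ∀ k, List (tm.Γ k)) :
    ∃ v', E.get v'.2 = (TM2.stepAux q (E.get v.2) T).var ∧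
      TM2.stepAux (E.stmt ren exit q) v (E.put S T) =
        ⟨some (((TM2.stepAux q (E.get v.2) T).l.map ren).getD exit), v',
          E.put S (TM2.stepAux q (E.get v.2) T).stk⟩ := by
  induction q generalizing v T with
  | push k f q ih =>
    have := ih v (Function.update T k (f (E.get v.2) :: T k))
    rw [← update_put] at this
    simpa [stmt, put_stack] using this
  | peek k f q ih =>
    simp only [stmt, TM2.stepAux, put_stack, List.head?_map, Option.map_map]
    have := ih (v.1, E.set v.2 (f (E.get v.2) (T k).head?)) T
    simpa [E.get_set, Function.comp_def] using this
  | pop k f q ih =>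
    simp only [stmt, TM2.stepAux, put_stack, List.head?_map, Option.map_map, ← List.map_tail,
      update_put]
    have := ih (v.1, E.set v.2 (f (E.get v.2) (T k).head?)) (Function.update T k (T k).tail)
    simpa [E.get_set, Function.comp_def] using this
  | load f q ih =>
    have := ih (v.1, E.set v.2 (f (E.get v.2))) T
    simpa [stmt, E.get_set] using this
  | branch f q₁ q₂ ih₁ ih₂ =>
    cases h : f (E.get v.2)
    · simpa [stmt, h] using ih₂ v T
    · simpa [stmt, h] using ih₁ v T
  | goto f => exact ⟨v, rfl, rfl⟩
  | halt => exact ⟨v, rfl, rfl⟩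

/-- The embedded machine as a program. -/
def prog : Prog Γ τ where
  Lab := Option tm.Λ
  fin := by have := tm.ΛFin; infer_instance
  entry := none
  code ren exit
    -- An earlier call may have left anything in the memory, so it is reset first; this is the extra
    -- step in `runs_prog`.
    | none => .load (fun v => (v.1, E.set v.2 tm.initialState)) (.goto fun _ => ren (some tm.main))
    | some l => E.stmt (ren ∘ some) exit (tm.m l)

theorem runs_prog {S : ∀ k, List (Γ k)} {x : List (tm.Γ tm.k₀)} {y : List (tm.Γ tm.k₁)} {t : ℕ}
    (h : TM2OutputsInTime tm x (some y) t) :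
    E.prog.Runs (E.put S (initList tm x).stk) (E.put S (haltList tm y).stk) (1 + t) := by
  intro Λ m ren exit hm v
  have key : ∀ (n : ℕ) (c : tm.Cfg) (v : Var Γ τ), E.get v.2 = c.var →
      (flip bind tm.step)^[n] (some c) = some (haltList tm y) →
      ∃ v', Reach m n ⟨some ((c.l.map (ren ∘ some)).getD exit), v, E.put S c.stk⟩
        ⟨some exit, v', E.put S (haltList tm y).stk⟩ := by
    intro n
    induction n with
    | zero =>
      intro c v hv hc
      obtain rfl := Option.some.inj hc
      exact ⟨v, .refl _ _⟩
    | succ n ih =>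
      rintro ⟨l, w, T⟩ v hv hc
      rw [Function.iterate_succ_apply] at hc
      cases l with
      | none =>
        -- A halted configuration has no successor, so it cannot be followed by further steps that
        -- reach the final one.
        have h0 : ∀ n, (flip bind tm.step)^[n] none = none := by
          intro n
          induction n with
          | zero => rfl
          | succ n ih => rw [Function.iterate_succ_apply]; exact ih
        have : (flip bind tm.step) (some ⟨none, w, T⟩) = none := rfl
        rw [this, h0] at hc
        cases hc
      | some l =>
        obtain ⟨v', hv', e⟩ := E.stepAux_stmt (ren ∘ some) exit S (tm.m l) v T
        simp only at hv
        obtain ⟨v'', h''⟩ := ih (TM2.stepAux (tm.m l) (E.get v.2) T) v' hv' (by rw [hv]; exact hc)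
        refine ⟨v'', (Reach.trans (.single ?_) h'').mono (by omega)⟩
        · rw [← e]
          exact congrArg (fun q => some (TM2.stepAux q v (E.put S T))) (hm (some l))
  obtain ⟨v', h'⟩ := key h.steps (initList tm x) (v.1, E.set v.2 tm.initialState)
    (E.get_set _ _) h.evals_in_steps
  refine ⟨v', .trans (.single ?_) (h'.mono h.steps_le_m)⟩
  rw [TM2.step, hm]
  rfl

end Embedding

end Programs

/-! ### Programs that call given machines as subroutines -/

section Oracles

set_option linter.unusedSectionVars false

theorem initList_stk (tm : FinTM2) (x : List (tm.Γ tm.k₀)) :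
    (initList tm x).stk = Function.update (fun _ => []) tm.k₀ x := by
  funext k
  by_cases h : k = tm.k₀
  · subst h; simp [initList]
  · simp [initList, h]

theorem haltList_stk (tm : FinTM2) (y : List (tm.Γ tm.k₁)) :
    (haltList tm y).stk = Function.update (fun _ => []) tm.k₁ y := by
  funext k
  by_cases h : k = tm.k₁
  · subst h; simp [haltList]
  · simp [haltList, h]

/-- A machine that programs with stack alphabet `G` can call as a subroutine. -/
structure Oracle (G : Type) where
  /-- the machine -/
  tm : FinTM2
  /-- its stack alphabets are finite -/
  fin : ∀ k, Finite (tm.Γ k)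
  /-- translation of the argument -/
  dec : G → tm.Γ tm.k₀
  /-- translation of the result -/
  enc : tm.Γ tm.k₁ → G

/-- On a stack with contents `l` the oracle replaces `l` by `l'`, at a cost of at most `t`. -/
def Oracle.Computes {G : Type} (O : Oracle G) (l l' : List G) (t : ℕ) : Prop :=
  ∃ y t', Nonempty (TM2OutputsInTime O.tm (l.map O.dec).reverse (some y) t') ∧
    l' = (y.map O.enc).reverse ∧ 2 * l.length + 2 * l'.length + t' + 3 ≤ t

/-- The stacks of a program with oracles: an input and an output stack, working stacks, and the
stacks of the oracles. -/
inductive Stk (K : Type) {G J : Type} (O : J → Oracle G) : Type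
  | inp : Stk K O
  | out : Stk K O
  | work (k : K) : Stk K O
  | orc (j : J) (k : (O j).tm.K) : Stk K O

variable {K G J : Type} {O : J → Oracle G}

noncomputable instance : DecidableEq (Stk K O) := Classical.decEq _

instance [Finite K] [Finite J] : Finite (Stk K O) := by
  have := fun j => (O j).tm.kFin
  let φ : Stk K O → Bool ⊕ K ⊕ Σ j, (O j).tm.K
    | .inp => .inl false
    | .out => .inl true
    | .work k => .inr (.inl k)
    | .orc j k => .inr (.inr ⟨j, k⟩)
  apply Finite.of_injective φ
  intro a b h
  cases a <;> cases b <;> simp_all [φ]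

/-- The stack alphabets of a program with oracles. -/
@[reducible] def Stk.Sym (α β : Type) : Stk K O → Type
  | .inp => α
  | .out => β
  | .work _ => G
  | .orc j k => (O j).tm.Γ k

variable {α β : Type}

instance [Finite α] [Finite β] [Finite G] (s : Stk K O) : Finite (s.Sym α β) := by
  cases s with
  | inp => exact ‹Finite α›
  | out => exact ‹Finite β›
  | work k => exact ‹Finite G›
  | orc j k => exact (O j).fin k

variable (K O α β) in
/-- Programs with oracles. -/
abbrev OProg : Type 1 := Prog (Stk.Sym (K := K) (O := O) α β) (∀ j, (O j).tm.σ)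

variable (O α β) in
/-- All stacks, for given contents of the working stacks; the others are empty. -/
def full (S : K → List G) : ∀ s : Stk K O, List (s.Sym α β)
  | .inp => []
  | .out => []
  | .work k => S k
  | .orc _ _ => []

variable [DecidableEq K]

theorem update_full (S : K → List G) (k : K) (l : List G) :
    Function.update (full O α β S) (.work k) l = full O α β (Function.update S k l) := by
  funext s
  cases s with
  | inp => simp [full]
  | out => simp [full]
  | orc j k => simp [full]
  | work k' =>
    by_cases h : k' = k
    · subst h; simp [full]
    · simp [full, h]

/-- The position of an oracle in a program. -/
noncomputable def oracleEmbedding [DecidableEq J] (j : J) :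
    Embedding (O j).tm (Stk.Sym (K := K) (O := O) α β) (∀ j, (O j).tm.σ) where
  stack := .orc j
  inj _ _ h := by cases h; rfl
  sym _ := Equiv.refl _
  get v := v j
  set v s := Function.update v j s
  get_set _ _ := by simp

theorem oracleEmbedding_put [DecidableEq J] (j : J) (S : K → List G) (k : (O j).tm.K)
    (x : List ((O j).tm.Γ k)) :
    (oracleEmbedding j).put (full O α β S) (Function.update (fun _ => []) k x) =
      Function.update (full O α β S) (.orc j k) x := by
  symm
  apply Embedding.eq_put
  · intro k'
    by_cases h : k' = k
    · subst h
      exact (Function.update_self _ _ _).trans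
        ((List.map_id x).symm.trans (by rw [Function.update_self]; rfl))
    · simp [oracleEmbedding, h, full]
  · intro s h
    have := (h k).symm
    exact Function.update_of_ne this _ _

/-- Execution of a program with oracles, in terms of the working stacks. -/
def WRuns (P : OProg K O α β) (S S' : K → List G) (t : ℕ) : Prop :=
  P.Runs (full O α β S) (full O α β S') t

theorem WRuns.of_eq {P : OProg K O α β} {S S' S'' : K → List G} {t t' : ℕ}
    (h : WRuns P S S' t) (hS : S' = S'') (ht : t ≤ t') : WRuns P S S'' t' :=
  hS ▸ Prog.Runs.mono h ht

variable [Finite α] [Finite β] [Finite G]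

/-- Apply the oracle `j` to the contents of the stack `k`. -/
noncomputable def call [DecidableEq J] (j : J) (k : K) : OProg K O α β :=
  (Prog.move (.work k) (.orc j (O j).tm.k₀) (O j).dec).seq
    ((oracleEmbedding j).prog.seq (Prog.move (.orc j (O j).tm.k₁) (.work k) (O j).enc))

/-- The argument is moved in (2|l| + 1 steps), the machine runs (1 + t'), the result is moved back
(2|l'| + 1): this is the bound in `Oracle.Computes`. All oracle stacks are empty again afterwards,
so calls can be repeated. -/
theorem wRuns_call [DecidableEq J] {j : J} {k : K} {S S' : K → List G} {l : List G} {t : ℕ}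
    (h : (O j).Computes (S k) l t) (hS : Function.update S k l = S') :
    WRuns (call j k : OProg K O α β) S S' t := by
  subst hS
  obtain ⟨y, t', ⟨h⟩, rfl, ht⟩ := h
  have h₁ := Prog.runs_move (τ := ∀ j, (O j).tm.σ) (k := Stk.work k)
    (k' := Stk.orc j (O j).tm.k₀) (by simp) (O j).dec (full O α β S)
  have h₂ := (oracleEmbedding (K := K) (α := α) (β := β) j).runs_prog
    (S := full O α β (Function.update S k [])) h
  rw [initList_stk, haltList_stk, oracleEmbedding_put, oracleEmbedding_put, ← update_full] at h₂
  have h₃ := Prog.runs_move (τ := ∀ j, (O j).tm.σ) (k := Stk.orc j (O j).tm.k₁)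
    (k' := Stk.work k) (by simp) (O j).enc
    (Function.update (Function.update (full O α β S) (.work k) []) (.orc j (O j).tm.k₁) y)
  have e : Function.update (Function.update (full O α β S) (.work k) []) (.orc j (O j).tm.k₀)
      (((full O α β S (.work k)).map (O j).dec).reverse ++
        (full O α β S (.orc j (O j).tm.k₀) : List ((O j).tm.Γ _))) =
      Function.update (Function.update (full O α β S) (.work k) []) (.orc j (O j).tm.k₀)
        ((S k).map (O j).dec).reverse := by
    exact congrArg _ (List.append_nil _)
  rw [e] at h₁
  refine Prog.Runs.of_eq (h₁.seq (h₂.seq h₃)) ?_ ?_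
  · rw [← update_full]
    funext s
    by_cases hs : s = .work k
    · subst hs; simp
    · by_cases hs' : s = .orc j (O j).tm.k₁
      · subst hs'; simp [full]
      · simp [hs, hs']
  · simp [full] at ht ⊢
    omega

theorem wRuns_skip (S : K → List G) : WRuns (Prog.skip : OProg K O α β) S S 1 :=
  Prog.runs_skip _

theorem wRuns_push {k : K} {g : G} {S S' : K → List G}
    (h : Function.update S k (g :: S k) = S') :
    WRuns (Prog.push (.work k) g : OProg K O α β) S S' 1 := by
  rw [WRuns, ← h, ← update_full]
  exact Prog.runs_push (.work k) g (full O α β S)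

theorem WRuns.seq {P Q : OProg K O α β} {S S' S'' : K → List G} {t t' : ℕ}
    (hP : WRuns P S S' t) (hQ : WRuns Q S' S'' t') : WRuns (P.seq Q) S S'' (t + t') :=
  Prog.Runs.seq hP hQ

theorem WRuns.case {k : K} {P : Option G → OProg K O α β} {S S₁ S' : K → List G} {t : ℕ}
    {o : Option G} (ho : (S k).head? = o) (hS : Function.update S k (S k).tail = S₁)
    (h : WRuns (P o) S₁ S' t) : WRuns (Prog.case (.work k) P) S S' (1 + t) := by
  rw [WRuns, ← hS, ← update_full, ← ho] at h
  exact Prog.Runs.case (k := Stk.work k) h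

theorem wRuns_loop_nil {k : K} {P : G → OProg K O α β} {S : K → List G} (h : S k = []) :
    WRuns (Prog.loop (.work k) P) S S 1 :=
  Prog.runs_loop_nil (k := Stk.work k) h

theorem WRuns.loop_cons {k : K} {P : G → OProg K O α β} {S S₁ S' S'' : K → List G} {t t' : ℕ}
    {g : G} {l : List G} (h : S k = g :: l) (hS : Function.update S k l = S₁)
    (hg : WRuns (P g) S₁ S' t) (hl : WRuns (Prog.loop (.work k) P) S' S'' t') :
    WRuns (Prog.loop (.work k) P) S S'' (1 + t + t') := by
  rw [WRuns, ← hS, ← update_full] at hg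
  exact Prog.Runs.loop_cons (k := Stk.work k) h hg hl

theorem wRuns_move {k k' : K} (hk : k ≠ k') {φ : G → G} {S S' : K → List G}
    (h : Function.update (Function.update S k []) k' (((S k).map φ).reverse ++ S k') = S') :
    WRuns (Prog.move (.work k) (.work k') φ : OProg K O α β) S S' (2 * (S k).length + 1) := by
  rw [WRuns, ← h, ← update_full, ← update_full]
  exact Prog.runs_move (k := Stk.work k) (k' := Stk.work k') (by simpa using hk) φ (full O α β S)

/-- Push the symbols of a list, one after the other. -/
noncomputable def pushList (k : K) : List G → OProg K O α β
  | [] => Prog.skip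
  | g :: l => (Prog.push (.work k) g).seq (pushList k l)

theorem wRuns_pushList {k : K} {l : List G} {S S' : K → List G}
    (h : Function.update S k (l.reverse ++ S k) = S') :
    WRuns (pushList k l : OProg K O α β) S S' (l.length + 1) := by
  induction l generalizing S with
  | nil =>
    obtain rfl : S = S' := by simpa using h
    exact wRuns_skip _
  | cons g l ih =>
    exact ((wRuns_push rfl).seq (ih (by simpa using h))).of_eq rfl (by simp; omega)

end Oracles

/-! ### Programs and polynomial time -/

theorem eval_mono (p : Polynomial ℕ) : Monotone fun n => p.eval n := by
  intro a b h
  simp only [Polynomial.eval_eq_sum_range]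
  gcongr

section PolyTime

set_option linter.unusedSectionVars false

variable {K G J : Type} {O : J → Oracle G} {α β : Type}

/-- The machine that runs a program. -/
noncomputable def machine [Finite K] [Finite J] [Finite α] [Finite β] [Finite G]
    (P : OProg K O α β) : FinTM2 where
  K := Stk K O
  kFin := Fintype.ofFinite _
  k₀ := .inp
  k₁ := .out
  Γ := Stk.Sym α β
  Λ := Option P.Lab
  main := some P.entry
  ΛFin := by have := P.fin; exact Fintype.ofFinite _
  σ := Var (Stk.Sym (K := K) (O := O) α β) (∀ j, (O j).tm.σ)
  initialState := (none, fun j => (O j).tm.initialState)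
  σFin := by
    have := fun j => (O j).tm.σFin
    exact Fintype.ofFinite _
  Γk₀Fin := Fintype.ofFinite _
  m
    -- The final configuration `haltList` demands the initial memory, so it is restored just before
    -- halting.
    | none => .load (fun _ => (none, fun j => (O j).tm.initialState)) .halt
    | some l => P.code some none l

theorem machine_outputs [Finite K] [Finite J] [Finite α] [Finite β] [Finite G]
    (P : OProg K O α β) {x : List α} {y : List β} {t : ℕ}
    (h : P.Runs (Function.update (fun _ => []) .inp x) (Function.update (fun _ => []) .out y) t) :
    Nonempty (TM2OutputsInTime (machine P) x (some y) (t + 1)) := by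
  obtain ⟨v', n, hn, e⟩ := h _ (machine P).m some none (fun _ => rfl) (machine P).initialState
  refine ⟨⟨⟨1 + n, ?_⟩, (by omega : 1 + n ≤ t + 1)⟩⟩
  have h₀ : initList (machine P) x =
      ⟨some (some P.entry), (machine P).initialState, Function.update (fun _ => []) .inp x⟩ := by
    exact congrArg (fun T => (⟨some (some P.entry), (machine P).initialState, T⟩ :
      (machine P).Cfg)) (initList_stk (machine P) x)
  have h₁ : haltList (machine P) y =
      ⟨none, (machine P).initialState, Function.update (fun _ => []) .out y⟩ := by
    exact congrArg (fun T => (⟨none, (machine P).initialState, T⟩ : (machine P).Cfg))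
      (haltList_stk (machine P) y)
  rw [Function.iterate_add_apply, h₀]
  refine (congrArg _ e).trans ?_
  exact congrArg some h₁.symm

theorem polyTimeOn_of_wRuns [DecidableEq K] [Finite K] [Finite J] [Finite α] [Finite β] [Finite G]
    {A : Set (List α)} {f : List α → List β} (P : OProg K O α β) (kin kout : K)
    (ein : α → G) (dout : G → β) (p : Polynomial ℕ)
    (h : ∀ x ∈ A, ∃ l, WRuns P (Function.update (fun _ => []) kin (x.map ein).reverse)
      (Function.update (fun _ => []) kout l) (p.eval x.length) ∧ (l.map dout).reverse = f x ∧
      (f x).length ≤ p.eval x.length) : PolyTimeOn A f := by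
  let Q : OProg K O α β := (Prog.move .inp (.work kin) ein).seq
    (P.seq (Prog.move (.work kout) .out dout))
  -- With n = |x|: 2n + 1 steps to read the input, p(n) for the program, at most 2p(n) + 1 to write
  -- the output, and one to reset the memory.
  refine ⟨⟨machine Q, Equiv.refl _, Equiv.refl _⟩, 3 * p + 2 * Polynomial.X + 3,
    fun s : Stk K O => inferInstanceAs (Finite (Stk.Sym α β s)), fun x hx => ?_⟩
  obtain ⟨l, hl, e, hf⟩ := h x hx
  have h₁ := Prog.runs_move (τ := ∀ j, (O j).tm.σ) (k := (Stk.inp : Stk K O))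
    (k' := Stk.work kin) (by simp) ein
    (Function.update (fun _ => []) Stk.inp x : ∀ s : Stk K O, List (s.Sym α β))
  have h₂ := Prog.runs_move (τ := ∀ j, (O j).tm.σ) (k := (Stk.work kout : Stk K O))
    (k' := Stk.out) (by simp) dout (full O α β (Function.update (fun _ => []) kout l))
  have h₀ : full O α β (fun _ : K => []) = fun _ => [] := by
    funext s
    cases s <;> rfl
  have e₁ : full O α β (Function.update (fun _ => []) kin (x.map ein).reverse) =
      (Function.update (fun _ => []) (Stk.work kin) (x.map ein).reverse :
        ∀ s : Stk K O, List (s.Sym α β)) := by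
    rw [← update_full, h₀]
  have e₂ : full O α β (Function.update (fun _ => []) kout l) =
      (Function.update (fun _ => []) (Stk.work kout) l :
        ∀ s : Stk K O, List (s.Sym α β)) := by
    rw [← update_full, h₀]
  have hr := machine_outputs Q (x := x) (y := f x) (t := 3 * p.eval x.length + 2 * x.length + 2) <| by
    rw [WRuns, e₁, e₂] at hl
    rw [e₂] at h₂
    refine (Prog.Runs.seq (h₁.of_eq ?_ le_rfl) (hl.seq h₂)).of_eq ?_ ?_
    · funext s
      cases s with
      | inp => simp
      | out => simp
      | work k =>
        by_cases hk : k = kin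
        · subst hk; simp
        · simp [hk]
      | orc j k => simp
    · rw [← e]
      funext s
      cases s with
      | inp => simp
      | out => simp
      | work k =>
        by_cases hk : k = kout
        · subst hk; simp
        · simp
      | orc j k => simp
    · have : l.length = (f x).length := by rw [← e]; simp
      simp
      omega
  have hx' : x.map (Equiv.refl α).invFun = x := List.map_id x
  have hfx' : (f x).map (Equiv.refl β).invFun = f x := List.map_id _
  have hp : (3 * p + 2 * Polynomial.X + 3 : Polynomial ℕ).eval x.length =
      3 * p.eval x.length + 2 * x.length + 2 + 1 := by
    simp
  rw [hp]
  exact hx'.symm ▸ hfx'.symm ▸ hr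

/-- The number of symbols that a statement can push. -/
def pushes {K : Type} {Γ : K → Type} {Λ σ : Type} : TM2.Stmt Γ Λ σ → ℕ
  | .push _ _ q => pushes q + 1
  | .peek _ _ q => pushes q
  | .pop _ _ q => pushes q
  | .load _ q => pushes q
  | .branch _ q₁ q₂ => pushes q₁ + pushes q₂
  | .goto _ => 0
  | .halt => 0

theorem length_stepAux {K : Type} [DecidableEq K] {Γ : K → Type} {Λ σ : Type}
    (q : TM2.Stmt Γ Λ σ) (v : σ) (S : ∀ k, List (Γ k)) (k : K) :
    ((TM2.stepAux q v S).stk k).length ≤ (S k).length + pushes q := by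
  induction q generalizing v S with
  | push k' f q ih =>
    refine (ih _ _).trans ?_
    by_cases h : k = k'
    · subst h; simp [pushes]; omega
    · simp [pushes, h]
  | peek k' f q ih => exact ih _ _
  | pop k' f q ih =>
    refine (ih _ _).trans ?_
    by_cases h : k = k'
    · subst h; simp [pushes]
    · simp [pushes, h]
  | load f q ih => exact ih _ _
  | branch f q₁ q₂ ih₁ ih₂ =>
    cases h : f v
    · have := ih₂ v S
      simp only [TM2.stepAux, h, cond_false, pushes]
      omega
    · have := ih₁ v S
      simp only [TM2.stepAux, h, cond_true, pushes]
      omega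
  | goto f => simp [pushes]
  | halt => simp [pushes]

/-- A step executes one statement, so it lengthens any stack by at most the total number of pushes
in the code. The bound on output length is what keeps compositions polynomial. -/
theorem exists_length_output_le (tm : FinTM2) : ∃ C, ∀ x y t,
    TM2OutputsInTime tm x (some y) t → y.length ≤ x.length + C * t := by
  have := tm.ΛFin
  refine ⟨∑ l, pushes (tm.m l), fun x y t h => ?_⟩
  set C := ∑ l, pushes (tm.m l)
  have key : ∀ (n : ℕ) (c : tm.Cfg) (k : tm.K), (flip bind tm.step)^[n] (some c) =
      some (haltList tm y) → ((haltList tm y).stk k).length ≤ (c.stk k).length + C * n := by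
    intro n
    induction n with
    | zero =>
      intro c k hc
      obtain rfl := Option.some.inj hc
      simp
    | succ n ih =>
      rintro ⟨l, w, T⟩ k hc
      rw [Function.iterate_succ_apply] at hc
      cases l with
      | none =>
        have h0 : ∀ n, (flip bind tm.step)^[n] none = none := by
          intro n
          induction n with
          | zero => rfl
          | succ n ih => rw [Function.iterate_succ_apply]; exact ih
        have : (flip bind tm.step) (some ⟨none, w, T⟩) = none := rfl
        rw [this, h0] at hc
        cases hc
      | some l =>
        have h1 := ih (TM2.stepAux (tm.m l) w T) k hc
        have h2 := length_stepAux (tm.m l) w T k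
        have h3 : pushes (tm.m l) ≤ C :=
          Finset.single_le_sum (f := fun l => pushes (tm.m l)) (fun _ _ => Nat.zero_le _)
            (Finset.mem_univ l)
        show _ ≤ (T k).length + _
        rw [Nat.mul_succ]
        omega
  have h1 := key h.steps _ tm.k₁ h.evals_in_steps
  rw [haltList_stk, initList_stk] at h1
  -- Input and output stack may coincide; then the output stack starts with |x| symbols rather than
  -- empty.
  have h2 : (Function.update (fun _ => []) tm.k₀ x tm.k₁ : List (tm.Γ tm.k₁)).length ≤ x.length := by
    by_cases hk : tm.k₁ = tm.k₀
    · generalize tm.k₁ = k at hk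
      subst hk
      simp
    · simp [hk]
  have h3 : C * h.steps ≤ C * t := Nat.mul_le_mul_left _ h.steps_le_m
  simp only [Function.update_self] at h1
  omega

theorem PolyTimeOn.exists_length_le {A : Set (List α)} {f : List α → List β}
    (hf : PolyTimeOn A f) : ∃ q : Polynomial ℕ, ∀ x ∈ A, (f x).length ≤ q.eval x.length := by
  obtain ⟨M, p, -, h⟩ := hf
  obtain ⟨C, hC⟩ := exists_length_output_le M.tm
  refine ⟨Polynomial.X + Polynomial.C C * p, fun x hx => ?_⟩
  obtain ⟨hx⟩ := h x hx
  simpa using hC _ _ _ hx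

theorem PolyTimeOn.exists_oracle {A : Set (List α)} {f : List α → List β} (hf : PolyTimeOn A f)
    (din : G → α) (eout : β → G) : ∃ (O : Oracle G) (q : Polynomial ℕ), ∀ l : List G,
      (l.map din).reverse ∈ A →
      O.Computes l ((f (l.map din).reverse).map eout).reverse (q.eval l.length) := by
  obtain ⟨q, hq⟩ := hf.exists_length_le
  obtain ⟨M, p, hM, h⟩ := hf
  refine ⟨⟨M.tm, hM, M.inputAlphabet.symm ∘ din, eout ∘ M.outputAlphabet⟩,
    2 * Polynomial.X + 2 * q + p + 3, fun l hl => ?_⟩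
  have h₁ := h _ hl
  have h₂ := hq _ hl
  rw [List.length_reverse, List.length_map] at h₁ h₂
  refine ⟨(f (l.map din).reverse).map M.outputAlphabet.invFun, p.eval l.length, ?_, ?_, ?_⟩
  · simpa [Function.comp_def, List.map_reverse] using h₁
  · simp [Function.comp_def]
  · simp
    omega

theorem PolyTimeOn.finite_left {A : Set (List α)} {f : List α → List β} (hf : PolyTimeOn A f) :
    Finite α := by
  obtain ⟨M, p, hM, -⟩ := hf
  have := hM M.tm.k₀
  exact Finite.of_equiv _ M.inputAlphabet

theorem PolyTimeOn.finite_right {A : Set (List α)} {f : List α → List β} (hf : PolyTimeOn A f) :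
    Finite β := by
  obtain ⟨M, p, hM, -⟩ := hf
  have := hM M.tm.k₁
  exact Finite.of_equiv _ M.outputAlphabet

theorem PolyTimeOn.mono {A B : Set (List α)} {f : List α → List β} (hf : PolyTimeOn B f)
    (h : A ⊆ B) : PolyTimeOn A f := by
  obtain ⟨M, p, hM, hf⟩ := hf
  exact ⟨M, p, hM, fun x hx => hf x (h hx)⟩

theorem PolyTimeOn.congr {A : Set (List α)} {f g : List α → List β} (hf : PolyTimeOn A f)
    (h : ∀ x ∈ A, f x = g x) : PolyTimeOn A g := by
  obtain ⟨M, p, hM, hf⟩ := hf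
  exact ⟨M, p, hM, fun x hx => h x hx ▸ hf x hx⟩

theorem polyTimeOn_id [Finite α] : PolyTimeOn Set.univ (fun x : List α => x) := by
  have := Fintype.ofFinite α
  refine ⟨⟨idComputer α, Equiv.refl _, Equiv.refl _⟩, 1, fun _ => inferInstanceAs (Finite α),
    fun x _ => ⟨(idComputableInPolyTime (αΓ := α) (fun x : List α => x)).outputsFun x⟩⟩

theorem PolyTimeOn.comp {γ : Type} [Nonempty α] [Nonempty β] [Nonempty γ] {A : Set (List α)}
    {B : Set (List β)} {f : List α → List β} {g : List β → List γ} (hg : PolyTimeOn B g)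
    (hf : PolyTimeOn A f) (hAB : Set.MapsTo f A B) : PolyTimeOn A (fun x => g (f x)) := by
  have := hf.finite_left
  have := hf.finite_right
  have := hg.finite_right
  obtain ⟨a⟩ := ‹Nonempty α›
  obtain ⟨b⟩ := ‹Nonempty β›
  obtain ⟨c⟩ := ‹Nonempty γ›
  obtain ⟨qf, hqf⟩ := hf.exists_length_le
  obtain ⟨qg, hqg⟩ := hg.exists_length_le
  -- All working stacks share one alphabet, so it is the product of the three; a letter occupies its
  -- own component and the others hold arbitrary defaults.
  obtain ⟨O₁, q₁, h₁⟩ := hf.exists_oracle (G := α × β × γ) (fun g => g.1) (fun y => (a, y, c))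
  obtain ⟨O₂, q₂, h₂⟩ := hg.exists_oracle (G := α × β × γ) (fun g => g.2.1) (fun z => (a, b, z))
  let O : Bool → Oracle (α × β × γ) := fun j => cond j O₁ O₂
  refine polyTimeOn_of_wRuns (K := Unit) (O := O) ((call true ()).seq (call false ())) () ()
    (fun x => (x, b, c)) (fun g => g.2.2) (q₁ + q₂.comp qf + qg.comp qf)
    (fun x hx => ⟨((g (f x)).map fun z => (a, b, z)).reverse, ?_, ?_, ?_⟩)
  · have e₁ := h₁ (x.map fun x => (x, b, c)).reverse
      (by simpa [List.map_reverse, Function.comp_def] using hx)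
    simp only [List.map_reverse, List.map_map, Function.comp_def, List.map_id', List.reverse_reverse,
      List.length_reverse, List.length_map] at e₁
    have e₂ := h₂ ((f x).map fun y => (a, y, c)).reverse
      (by simpa [List.map_reverse, Function.comp_def] using hAB hx)
    simp only [List.map_reverse, List.map_map, Function.comp_def, List.map_id', List.reverse_reverse,
      List.length_reverse, List.length_map] at e₂
    have r₁ : WRuns (call true () : OProg Unit O α γ)
        (Function.update (fun _ => []) () (x.map fun x => (x, b, c)).reverse) _ _ :=
      wRuns_call (O := O) (j := true) (by simpa [O] using e₁) rfl
    have r₂ : WRuns (call false () : OProg Unit O α γ)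
        (Function.update (fun _ => []) () ((f x).map fun y => (a, y, c)).reverse) _ _ :=
      wRuns_call (O := O) (j := false) (by simpa [O] using e₂) rfl
    rw [Function.update_idem] at r₁ r₂
    refine (r₁.seq r₂).of_eq rfl ?_
    have := eval_mono q₂ (hqf x hx)
    simp at this ⊢
    omega
  · simp [Function.comp_def]
  · have := (hqg _ (hAB hx)).trans (eval_mono qg (hqf x hx))
    simp at this ⊢
    omega

end PolyTime

/-! ### Strings as numbers -/

section Numerals

set_option linter.unusedSectionVars false

variable {α : Type} [Fintype α] [LinearOrder α]

/-- The number of letters before `a`. -/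
noncomputable def idx (a : α) : ℕ := (monoEquivOfFin α rfl).symm a

theorem idx_lt_card (a : α) : idx a < Fintype.card α := ((monoEquivOfFin α rfl).symm a).2

theorem idx_lt_idx {a b : α} : idx a < idx b ↔ a < b := by
  rw [idx, idx, ← Fin.lt_def]
  exact (monoEquivOfFin α rfl).symm.lt_iff_lt

theorem idx_injective : Function.Injective (idx : α → ℕ) := by
  intro a b h
  exact (monoEquivOfFin α rfl).symm.injective (Fin.ext h)

theorem exists_idx_eq {i : ℕ} (h : i < Fintype.card α) : ∃ a : α, idx a = i :=
  ⟨monoEquivOfFin α rfl ⟨i, h⟩, by simp [idx]⟩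

/-- The number denoted by a string in bijective base `|α|`, least significant digit first. -/
noncomputable def rval : List α → ℕ
  | [] => 0
  | a :: l => idx a + 1 + Fintype.card α * rval l

/-- The number denoted by a string in bijective base `|α|`. -/
noncomputable def val (x : List α) : ℕ := rval x.reverse

theorem rval_nil : rval ([] : List α) = 0 := rfl

theorem rval_cons (a : α) (l : List α) : rval (a :: l) = idx a + 1 + Fintype.card α * rval l := rfl

theorem val_concat (x : List α) (a : α) :
    val (x ++ [a]) = idx a + 1 + Fintype.card α * val x := by
  simp [val, rval_cons]

/-- The digits i + 1 and j + 1 lie between 1 and b, so the last digit matters only if the leading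
parts agree. -/
theorem add_mul_lt_add_mul_iff {b i j u v : ℕ} (hi : i < b) (hj : j < b) :
    i + 1 + b * u < j + 1 + b * v ↔ u < v ∨ u = v ∧ i < j := by
  rcases lt_trichotomy u v with h | rfl | h
  · have : b * (u + 1) ≤ b * v := Nat.mul_le_mul_left _ h
    rw [Nat.mul_succ] at this
    constructor
    · intro; exact .inl h
    · intro; omega
  · simp
  · have : b * (v + 1) ≤ b * u := Nat.mul_le_mul_left _ h
    rw [Nat.mul_succ] at this
    constructor <;> intro <;> omega

theorem rval_injective : Function.Injective (rval : List α → ℕ) := by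
  intro l
  induction l with
  | nil =>
    intro m h
    cases m with
    | nil => rfl
    | cons b m => rw [rval_cons, rval_nil] at h; omega
  | cons a l ih =>
    intro m h
    cases m with
    | nil => simp [rval] at h
    | cons b m =>
      rw [rval_cons, rval_cons] at h
      have h₁ := (add_mul_lt_add_mul_iff (u := rval l) (v := rval m) (idx_lt_card a)
        (idx_lt_card b)).not.mp h.not_lt
      have h₂ := (add_mul_lt_add_mul_iff (u := rval m) (v := rval l) (idx_lt_card b)
        (idx_lt_card a)).not.mp h.not_gt
      have h₃ : rval l = rval m := by omega
      rw [ih h₃, idx_injective (show idx a = idx b by omega)]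

theorem val_injective : Function.Injective (val : List α → ℕ) :=
  rval_injective.comp List.reverse_injective

theorem rval_surjective [Nonempty α] : Function.Surjective (rval : List α → ℕ) := by
  intro n
  induction n using Nat.strong_induction_on with
  | _ n ih =>
    cases n with
    | zero => exact ⟨[], rfl⟩
    | succ n =>
      have hc : 0 < Fintype.card α := Fintype.card_pos
      obtain ⟨l, hl⟩ := ih (n / Fintype.card α) (Nat.lt_succ_of_le (Nat.div_le_self _ _))
      obtain ⟨a, ha⟩ := exists_idx_eq (α := α) (Nat.mod_lt n hc)
      refine ⟨a :: l, ?_⟩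
      have := Nat.mod_add_div n (Fintype.card α)
      rw [rval_cons, hl, ha]
      omega

theorem val_surjective [Nonempty α] : Function.Surjective (val : List α → ℕ) :=
  rval_surjective.comp List.reverse_surjective

theorem lex_concat_iff {x y : List α} (h : x.length = y.length) (a b : α) :
    List.Lex (· < ·) (x ++ [a]) (y ++ [b]) ↔ List.Lex (· < ·) x y ∨ x = y ∧ a < b := by
  induction x generalizing y with
  | nil =>
    obtain rfl := List.length_eq_zero_iff.mp h.symm
    simp
  | cons c x ih =>
    obtain _ | ⟨d, y⟩ := y
    · simp at h
    · have := ih (by simpa using h)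
      simp only [List.cons_append, List.cons_lex_cons_iff, this, List.cons.injEq]
      tauto

/-- Induction on the last letter: both orders compare the prefixes first and the last letters only
in case of a tie. Hence `val` is an order isomorphism onto ℕ, and `numOfStr` is `val`. -/
theorem lexLT_iff_val_lt {x y : List α} : LexLT x y ↔ val x < val y := by
  induction x using List.reverseRecOn generalizing y with
  | nil =>
    rcases List.eq_nil_or_concat y with rfl | ⟨y, b, rfl⟩
    · simp [LexLT]
    · simp [LexLT, List.shortlex_def, List.concat_eq_append, val, rval]
  | append_singleton x a ih =>
    rcases List.eq_nil_or_concat y with rfl | ⟨y, b, rfl⟩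
    · simp [LexLT, val, rval]
    · rw [List.concat_eq_append, val_concat, val_concat,
        add_mul_lt_add_mul_iff (idx_lt_card a) (idx_lt_card b), ← ih, val_injective.eq_iff,
        idx_lt_idx, LexLT, LexLT, List.shortlex_def, List.shortlex_def]
      simp only [List.length_append, List.length_singleton, add_lt_add_iff_right,
        add_left_inj]
      constructor
      · rintro (h | ⟨h, h'⟩)
        · exact .inl (.inl h)
        · rw [lex_concat_iff h] at h'
          tauto
      · rintro ((h | ⟨h, h'⟩) | ⟨rfl, h⟩)
        · exact .inl h
        · exact .inr ⟨h, (lex_concat_iff h a b).2 (.inl h')⟩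
        · exact .inr ⟨rfl, (lex_concat_iff rfl a b).2 (.inr ⟨rfl, h⟩)⟩

/-- The bijection between strings and numbers. -/
noncomputable def strEquiv [Nonempty α] : List α ≃ ℕ :=
  Equiv.ofBijective val ⟨val_injective, val_surjective⟩

variable (α) in
/-- The string that denotes a number. -/
noncomputable def str [Nonempty α] (n : ℕ) : List α := (strEquiv (α := α)).symm n

theorem val_str [Nonempty α] (n : ℕ) : val (str α n) = n := strEquiv.apply_symm_apply n

theorem str_val [Nonempty α] (x : List α) : str α (val x) = x := strEquiv.symm_apply_apply x

theorem numOfStr_eq_val [Nonempty α] (x : List α) : numOfStr x = val x := by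
  have : {y : List α | LexLT y x} = val ⁻¹' (Finset.range (val x) : Set ℕ) := by
    ext y
    simp [lexLT_iff_val_lt]
  rw [numOfStr, this, Set.ncard_preimage_of_injective_subset_range val_injective
    (by simp [val_surjective.range_eq]), Set.ncard_coe_finset, Finset.card_range]

open Classical in
-- The ranking function counts x itself while `Nat.count` stops short of its argument, hence the
-- shift by one. In this form the inverse of ranking is `Nat.nth`.
theorem rank_eq_count [Nonempty α] (L : Language α) (x : List α) :
    rank L x = Nat.count (fun n => str α n ∈ L) (val x + 1) := by
  have : {y | y ∈ L ∧ (y = x ∨ LexLT y x)} =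
      val ⁻¹' ((Finset.range (val x + 1)).filter (fun n => str α n ∈ L) : Set ℕ) := by
    ext y
    simp only [Set.mem_ofPred_eq, lexLT_iff_val_lt, Set.mem_preimage, Finset.mem_coe,
      Finset.mem_filter, Finset.mem_range, str_val, ← val_injective.eq_iff]
    rw [and_comm]
    exact and_congr_left' (by omega)
  rw [rank, this, Set.ncard_preimage_of_injective_subset_range val_injective
    (by simp [val_surjective.range_eq]), Set.ncard_coe_finset, Nat.count_eq_card_filter_range]

/-- The summand 2 makes the induction close: multiplied by the base c it becomes 2c, enough for a
digit of at most c and again 2, as c ≥ 2. -/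
theorem rval_lt_pow [Nontrivial α] (l : List α) : rval l + 2 ≤ Fintype.card α ^ (l.length + 1) := by
  have hc : 2 ≤ Fintype.card α := Fintype.one_lt_card
  induction l with
  | nil => simpa [rval] using hc
  | cons a l ih =>
    have h := idx_lt_card a
    have := Nat.mul_le_mul_left (Fintype.card α) ih
    rw [rval_cons, List.length_cons, pow_succ']
    rw [Nat.mul_add] at this
    omega

theorem val_lt_pow [Nontrivial α] (x : List α) : val x < Fintype.card α ^ (x.length + 1) := by
  have := rval_lt_pow x.reverse
  rw [List.length_reverse] at this
  rw [val]
  omega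

theorem length_le_of_val_le {x y : List α} (h : val x ≤ val y) : x.length ≤ y.length := by
  by_contra! hl
  have : LexLT y x := List.Shortlex.of_length_lt hl
  rw [lexLT_iff_val_lt] at this
  omega

end Numerals

/-! ### Transducers -/

/-- The output of a transducer that starts in state `q`: on reading `a` in state `q` it writes
`out q a` and goes to the state `next q a`; at the end it writes `fin q`. -/
def transduce {α β σ : Type} (next : σ → α → σ) (out : σ → α → List β) (fin : σ → List β) :
    σ → List α → List β
  | q, [] => fin q
  | q, a :: l => out q a ++ transduce next out fin (next q a) l

theorem polyTimeOn_transduce {α β σ : Type} [Finite α] [Finite β] [Finite σ] [Nonempty α]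
    [Nonempty β] (next : σ → α → σ) (out : σ → α → List β) (fin : σ → List β) (q₀ : σ) :
    PolyTimeOn Set.univ (fun x : List α => (transduce next out fin q₀ x.reverse).reverse) := by
  obtain ⟨a₀⟩ := ‹Nonempty α›
  obtain ⟨b₀⟩ := ‹Nonempty β›
  have hC : ∃ C, (∀ q a, (out q a).length ≤ C) ∧ ∀ q, (fin q).length ≤ C := by
    obtain ⟨C₁, h₁⟩ := (Set.finite_range fun r : σ × α => (out r.1 r.2).length).bddAbove
    obtain ⟨C₂, h₂⟩ := (Set.finite_range fun q => (fin q).length).bddAbove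
    exact ⟨max C₁ C₂, fun q a => le_max_of_le_left (h₁ ⟨(q, a), rfl⟩),
      fun q => le_max_of_le_right (h₂ ⟨q, rfl⟩)⟩
  obtain ⟨C, hout, hfin⟩ := hC
  let O : Empty → Oracle (α × β × σ) := Empty.elim
  let ea : α → α × β × σ := fun a => (a, b₀, q₀)
  let eb : β → α × β × σ := fun b => (a₀, b, q₀)
  let es : σ → α × β × σ := fun q => (a₀, b₀, q)
  let body : α × β × σ → OProg (Fin 3) O α β := fun g =>
    Prog.case (.work 1) fun o : Option (α × β × σ) =>
    (pushList 2 ((out (o.getD g).2.2 g.1).map eb)).seq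
      (Prog.push (.work 1) (es (next (o.getD g).2.2 g.1)))
  let P : OProg (Fin 3) O α β := (Prog.push (.work 1) (es q₀)).seq
    ((Prog.loop (.work 0) body).seq
      ((Prog.case (.work 1) fun o : Option (α × β × σ) =>
        pushList 2 ((fin (o.getD (es q₀)).2.2).map eb)).seq
        (Prog.move (.work 2) (.work 0) id)))
  have loop : ∀ l q acc, ∃ q' w, transduce next out fin q l = w ++ fin q' ∧
      w.length ≤ C * l.length ∧ WRuns (Prog.loop (.work 0) body : OProg (Fin 3) O α β)
        ![l.map ea, [es q], acc] ![[], [es q'], (w.map eb).reverse ++ acc]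
        ((C + 4) * l.length + 1) := by
    intro l
    induction l with
    | nil => exact fun q acc => ⟨q, [], rfl, le_rfl, wRuns_loop_nil rfl⟩
    | cons a l ih =>
      intro q acc
      obtain ⟨q', w, e, hw, h⟩ := ih (next q a) (((out q a).map eb).reverse ++ acc)
      refine ⟨q', out q a ++ w, by rw [transduce, e, List.append_assoc], ?_, ?_⟩
      · have := hout q a
        simp only [List.length_append, List.length_cons, Nat.mul_succ]
        omega
      · refine (WRuns.loop_cons (g := ea a) (l := l.map ea) (S₁ := ![l.map ea, [es q], acc]) rfl
          ?_ (WRuns.case (o := some (es q)) (S₁ := ![l.map ea, [], acc]) rfl ?_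
            ((wRuns_pushList (S' := ![l.map ea, [], ((out q a).map eb).reverse ++ acc]) ?_).seq
              (wRuns_push ?_))) h).of_eq ?_ ?_
        · funext i; fin_cases i <;> rfl
        · funext i; fin_cases i <;> rfl
        · funext i; fin_cases i <;> rfl
        · funext i; fin_cases i <;> rfl
        · simp
        · have : (out ((some (es q)).getD (ea a)).2.2 (ea a).1).length ≤ C := hout q a
          simp only [List.length_map, List.length_cons, Nat.mul_succ]
          omega
  refine polyTimeOn_of_wRuns P 0 0 ea (fun g => g.2.1)
    (Polynomial.C (4 * C + 10) * (Polynomial.X + 1)) (fun x _ =>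
      ⟨(transduce next out fin q₀ x.reverse).map eb, ?_, by simp [eb, Function.comp_def], ?_⟩)
  all_goals
    obtain ⟨q', w, e, hw, h⟩ := loop x.reverse q₀ []
    rw [e]
    have hf := hfin q'
    rw [List.length_reverse] at hw
  · refine (WRuns.seq (wRuns_push (S' := ![x.reverse.map ea, [es q₀], []]) ?_) (h.seq (.seq
      (WRuns.case (S₁ := ![[], [], (w.map eb).reverse]) (o := some (es q')) rfl ?_
        (wRuns_pushList (S' := ![[], [], ((w ++ fin q').map eb).reverse]) ?_))
          (wRuns_move (by decide) rfl)))).of_eq ?_ ?_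
    · funext i; fin_cases i <;> simp
    · funext i; fin_cases i <;> simp
    · funext i; fin_cases i <;> simp [es]
    · funext i; fin_cases i <;> simp
    · simp [es]
      nlinarith
  · simp
    nlinarith

/-! ### Iterating over a string -/

/-- Polynomial-time steps alone could make the accumulator grow exponentially. As each step adds at
most C letters, all intermediate values have length at most C|x|, and each call is polynomial in
|x|. -/
theorem polyTimeOn_foldl {α β : Type} [Finite α] [Nonempty α] [Nonempty β]
    (T : α → List β → List β) (hT : ∀ a, PolyTimeOn Set.univ (T a)) (C : ℕ)
    (hC : ∀ a x, (T a x).length ≤ x.length + C) :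
    PolyTimeOn Set.univ (fun x : List α => x.foldl (fun acc a => T a acc) []) := by
  classical
  have := (hT (Classical.arbitrary α)).finite_right
  have := Fintype.ofFinite α
  let a₀ : α := Classical.arbitrary α
  let b₀ : β := Classical.arbitrary β
  choose O q hq using fun a => (hT a).exists_oracle (G := α × β) (fun g => g.2) (fun b => (a₀, b))
  let eb : β → α × β := fun b => (a₀, b)
  -- The fold starts with the first letter, which is at the bottom of stack 0; the move brings it to
  -- the top.
  let P : OProg (Fin 3) O α β := (Prog.move (.work 0) (.work 2) id).seq
    (Prog.loop (.work 2) fun g => call g.1 1)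
  let Q : Polynomial ℕ := ∑ a, q a
  have hQ : ∀ a n, (q a).eval n ≤ Q.eval n := by
    intro a n
    rw [Polynomial.eval_finsetSum]
    exact Finset.single_le_sum (f := fun a => (q a).eval n) (fun _ _ => Nat.zero_le _)
      (Finset.mem_univ a)
  have hlen : ∀ (x : List α) acc, (x.foldl (fun acc a => T a acc) acc).length ≤
      acc.length + C * x.length := by
    intro x
    induction x with
    | nil => simp
    | cons a x ih =>
      intro acc
      have h₁ := ih (T a acc)
      have h₂ := hC a acc
      rw [List.foldl_cons, List.length_cons, Nat.mul_succ]
      omega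
  have loop : ∀ (x : List α) acc n, acc.length + C * x.length ≤ n →
      WRuns (Prog.loop (.work 2) fun g => call g.1 1 : OProg (Fin 3) O α β)
        ![[], (acc.map eb).reverse, x.map fun a => (a, b₀)]
        ![[], ((x.foldl (fun acc a => T a acc) acc).map eb).reverse, []]
        (x.length * (1 + Q.eval n) + 1) := by
    intro x
    induction x with
    | nil => intro acc n _; exact (wRuns_loop_nil rfl).of_eq rfl (by simp)
    | cons a x ih =>
      intro acc n hn
      have h := hq a (acc.map eb).reverse (Set.mem_univ _)
      simp only [List.map_reverse, List.map_map, Function.comp_def, eb, List.map_id',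
        List.reverse_reverse, List.length_reverse, List.length_map] at h
      rw [List.length_cons, Nat.mul_succ] at hn
      have h' := hC a acc
      refine (WRuns.loop_cons (g := (a, b₀)) (l := x.map fun a => (a, b₀))
        (S₁ := ![[], (acc.map eb).reverse, x.map fun a => (a, b₀)]) rfl ?_
        (wRuns_call (S' := ![[], ((T a acc).map eb).reverse, x.map fun a => (a, b₀)]) h ?_)
        (ih (T a acc) n (by omega))).of_eq rfl ?_
      · funext i; fin_cases i <;> rfl
      · funext i; fin_cases i <;> rfl
      · have h₁ := (hQ a acc.length).trans (eval_mono Q (show acc.length ≤ n by omega))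
        rw [List.length_cons, Nat.succ_mul]
        simp only at h₁
        omega
  refine polyTimeOn_of_wRuns P 0 1 (fun a => (a, b₀)) (fun g => g.2)
    (2 * Polynomial.X + Polynomial.C C * Polynomial.X + 2 +
      Polynomial.X * (1 + Q.comp (Polynomial.C C * Polynomial.X)))
    (fun x _ => ⟨((x.foldl (fun acc a => T a acc) []).map eb).reverse, ?_, ?_, ?_⟩)
  · refine ((wRuns_move (S' := ![[], [], x.map fun a => (a, b₀)]) (by decide) ?_).seq
      (loop x [] (C * x.length) (by simp))).of_eq ?_ ?_
    · funext i; fin_cases i <;> simp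
    · funext i; fin_cases i <;> simp
    · simp
      omega
  · simp [eb, Function.comp_def]
  · have := hlen x []
    simp at this ⊢
    omega

/-! ### Arithmetic -/

section Arithmetic

variable {α β : Type} [Fintype α] [LinearOrder α] [Nontrivial α]
  [Fintype β] [LinearOrder β] [Nontrivial β]

variable (β) in
/-- The letter with `i` letters before it. -/
noncomputable def letter (i : ℕ) : β := Function.invFun idx i

theorem idx_letter {i : ℕ} (h : i < Fintype.card β) : idx (letter β i) = i :=
  Function.invFun_eq (exists_idx_eq h)

/-- School multiplication from the least significant digit, with the carry as state. Digits start at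
1, so u ≥ 1 is split into the digit (u − 1) mod B + 1 and the carry (u − 1) / B. -/
theorem polyTimeOn_mul_add (m c : ℕ) (hm : 0 < m) :
    PolyTimeOn Set.univ (fun x : List β => str β (m * val x + c)) ∧
      ∃ C, ∀ x : List β, (str β (m * val x + c)).length ≤ x.length + C := by
  have hB : 1 < Fintype.card β := Fintype.one_lt_card
  set B := Fintype.card β
  -- The carries 0, …, 2m + c include the initial one c and are closed under the transition, because
  -- B ≥ 2.
  have hN : ∀ (r : Fin (2 * m + c + 1)) (d : β), (m * (idx d + 1) + r - 1) / B < 2 * m + c + 1 := by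
    intro r d
    rw [Nat.div_lt_iff_lt_mul (by omega)]
    have h₁ : m * (idx d + 1) ≤ m * B := Nat.mul_le_mul_left _ (idx_lt_card d)
    have h₂ := r.2
    have h₃ : (m + c + 1) * 2 ≤ (m + c + 1) * B := Nat.mul_le_mul_left _ hB
    have h₄ : (2 * m + c + 1) * B = m * B + (m + c + 1) * B := by ring
    omega
  let next : Fin (2 * m + c + 1) → β → Fin (2 * m + c + 1) := fun r d => ⟨_, hN r d⟩
  let out : Fin (2 * m + c + 1) → β → List β := fun r d =>
    [letter β ((m * (idx d + 1) + r - 1) % B)]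
  let fin : Fin (2 * m + c + 1) → List β := fun r => (str β r).reverse
  have key : ∀ l r, rval (transduce next out fin r l) = m * rval l + r := by
    intro l
    induction l with
    | nil =>
      intro r
      have := val_str (α := β) r
      rw [val] at this
      simp only [transduce, fin, rval_nil, this]
      omega
    | cons d l ih =>
      intro r
      -- Positivity of m ensures that the subtraction of 1 is not truncated.
      have h₀ : 0 < m * (idx d + 1) := by positivity
      simp only [transduce, out, List.cons_append, List.nil_append]
      rw [rval_cons, rval_cons, ih, idx_letter (Nat.mod_lt _ (by omega))]
      have h₁ := Nat.mod_add_div (m * (idx d + 1) + r - 1) B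
      have h₃ : m * (idx d + 1 + B * rval l) = m * (idx d + 1) + m * (B * rval l) := Nat.mul_add ..
      have h₂ : B * (m * rval l + (next r d : ℕ)) =
        m * (B * rval l) + B * ((m * (idx d + 1) + r - 1) / B) := by simp only [next]; ring
      change (m * (idx d + 1) + r - 1) % B + 1 + B * _ = m * (_ + B * _) + _
      rw [h₂, h₃]
      generalize m * (idx d + 1) = u at *
      omega
  have hlen : ∀ l r, (transduce next out fin r l).length ≤
      l.length + (str β (2 * m + c)).length := by
    intro l
    induction l with
    | nil =>
      intro r
      simp only [transduce, fin, List.length_reverse, List.length_nil, zero_add]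
      apply length_le_of_val_le
      rw [val_str, val_str]
      omega
    | cons d l ih =>
      intro r
      have := ih (next r d)
      have h₁ : (out r d).length = 1 := rfl
      rw [transduce, List.length_append, h₁, List.length_cons]
      omega
  have e : ∀ x : List β, (transduce next out fin ⟨c, by omega⟩ x.reverse).reverse =
      str β (m * val x + c) := by
    intro x
    apply val_injective
    rw [val_str, val, List.reverse_reverse, key]
    rfl
  refine ⟨(polyTimeOn_transduce next out fin _).congr fun x _ => e x,
    (str β (2 * m + c)).length, fun x => ?_⟩
  rw [← e, List.length_reverse]
  simpa using hlen x.reverse ⟨c, by omega⟩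

theorem polyTimeOn_succ : PolyTimeOn Set.univ (fun x : List β => str β (val x + 1)) := by
  simpa using (polyTimeOn_mul_add (β := β) 1 1 one_pos).1

/-- Horner's rule: appending a letter acts on the value by an affine map, which adds boundedly many
digits in the new base. -/
theorem polyTimeOn_convert : PolyTimeOn Set.univ (fun x : List α => str β (val x)) := by
  have hm : 0 < Fintype.card α := Fintype.card_pos
  choose C hC using fun a : α =>
    (polyTimeOn_mul_add (β := β) (Fintype.card α) (idx a + 1) hm).2
  refine (polyTimeOn_foldl (fun a x => str β (Fintype.card α * val x + (idx a + 1)))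
    (fun a => (polyTimeOn_mul_add _ _ hm).1) (∑ a, C a) (fun a x => (hC a x).trans ?_)).congr
    fun x hx => ?_
  · have := Finset.single_le_sum (f := C) (fun _ _ => Nat.zero_le _) (Finset.mem_univ a)
    omega
  · clear hx
    apply val_injective
    rw [val_str]
    induction x using List.reverseRecOn with
    | nil => rfl
    | append_singleton x a ih =>
      rw [List.foldl_append, List.foldl_cons, List.foldl_nil, val_str, ih, val_concat]
      omega

/-- Lowering the digit 1 would leave a 0, which is not a digit. In state `some false` such a
position is pending: if another digit follows, it becomes B and the next digit is lowered in turn;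
at the end of the numeral it vanishes. State `some true` copies. -/
theorem polyTimeOn_pred : PolyTimeOn Set.univ (fun x : List β => str β (val x - 1)) := by
  have hB : 1 < Fintype.card β := Fintype.one_lt_card
  let next : Option Bool → β → Option Bool := fun q d =>
    if q = some true ∨ idx d ≠ 0 then some true else some false
  let dec : β → List β := fun d => if idx d = 0 then [] else [letter β (idx d - 1)]
  let out : Option Bool → β → List β := fun q d => match q with
    | none => dec d
    | some false => letter β (Fintype.card β - 1) :: dec d
    | some true => [d]
  let fin : Option Bool → List β := fun _ => []
  have h₁ : ∀ l, transduce next out fin (some true) l = l := by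
    intro l
    induction l with
    | nil => rfl
    | cons d l ih => simp [transduce, next, out, ih]
  have h₂ : ∀ d : β, idx (letter β (idx d - 1)) = idx d - 1 := fun d => by
    have := idx_lt_card d
    exact idx_letter (by omega)
  have h₃ : ∀ l, rval (transduce next out fin (some false) l) = Fintype.card β * rval l := by
    intro l
    induction l with
    | nil => rfl
    | cons d l ih =>
      by_cases hd : idx d = 0
      · simp only [transduce, out, next, dec, hd, rval_cons, List.cons_append, List.nil_append, ih,
          if_true, ne_eq, not_true_eq_false, or_false, Option.some.injEq, Bool.false_eq_true,
          if_false, idx_letter (show Fintype.card β - 1 < Fintype.card β by omega)]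
        rw [Nat.mul_add]
        omega
      · simp only [transduce, out, next, dec, hd, rval_cons, List.cons_append, List.nil_append, h₁,
          ne_eq, not_false_eq_true, or_true, if_true, if_false, h₂,
          idx_letter (show Fintype.card β - 1 < Fintype.card β by omega)]
        rw [Nat.sub_add_cancel (by omega), Nat.sub_add_cancel (by omega)]
        ring
  refine (polyTimeOn_transduce next out fin none).congr fun x _ => ?_
  apply val_injective
  rw [val_str, val, val, List.reverse_reverse]
  cases x.reverse with
  | nil => rfl
  | cons d l =>
    by_cases hd : idx d = 0
    · simp [transduce, out, next, dec, hd, rval_cons, h₃]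
    · simp [transduce, out, next, dec, hd, rval_cons, h₁, h₂]
      omega

end Arithmetic

/-! ### Copying and comparing strings -/

section Subroutines

variable {K G J : Type} {O : J → Oracle G} {α β : Type} [DecidableEq K]
  [Finite α] [Finite β] [Finite G]

/-- Copy the stack `k` to `k'`, by way of the empty stack `t`. -/
noncomputable def copy (k k' t : K) : OProg K O α β :=
  (Prog.move (.work k) (.work t) id).seq
    (Prog.loop (.work t) fun g : G => (Prog.push (.work k) g).seq (Prog.push (.work k') g))

theorem wRuns_copy {k k' t : K} (h₁ : k ≠ k') (h₂ : k ≠ t) (h₃ : k' ≠ t) {S S' : K → List G}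
    (ht : S t = []) (h : Function.update S k' (S k ++ S k') = S') :
    WRuns (copy k k' t : OProg K O α β) S S' (5 * (S k).length + 2) := by
  have loop : ∀ (l : List G) (S : K → List G), S t = l →
      WRuns (Prog.loop (.work t) fun g : G =>
          (Prog.push (.work k) g).seq (Prog.push (.work k') g) : OProg K O α β) S
        (Function.update (Function.update (Function.update S t []) k (l.reverse ++ S k)) k'
          (l.reverse ++ S k')) (3 * l.length + 1) := by
    intro l
    induction l with
    | nil =>
      intro S hS
      refine (wRuns_loop_nil hS).of_eq ?_ (by simp)
      funext i
      by_cases i₁ : i = t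
      · subst i₁; simp [h₂.symm, h₃.symm, hS]
      · by_cases i₂ : i = k <;> by_cases i₃ : i = k' <;> simp_all
    | cons g l ih =>
      intro S hS
      refine (WRuns.loop_cons hS rfl ((wRuns_push rfl).seq (wRuns_push rfl))
        (ih _ (by simp [h₂.symm, h₃.symm]))).of_eq ?_ (by simp; omega)
      funext i
      by_cases i₁ : i = t
      · subst i₁; simp [h₂.symm, h₃.symm]
      · by_cases i₂ : i = k
        · subst i₂; simp [h₁, h₂]
        · by_cases i₃ : i = k'
          · subst i₃; simp [i₂, i₁]
          · simp [i₁, i₂, i₃]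
  refine ((wRuns_move h₂ rfl).seq (loop _ _ rfl)).of_eq ?_ (by simp [ht]; omega)
  rw [← h]
  funext i
  by_cases i₁ : i = t
  · subst i₁; simp [h₂.symm, h₃.symm, ht]
  · by_cases i₂ : i = k
    · subst i₂; simp [h₁, h₂, ht]
    · by_cases i₃ : i = k'
      · subst i₃; simp [i₂, i₁, ht]
      · simp [i₁, i₂, i₃]

variable {γ : Type} [Fintype γ] [LinearOrder γ]

/-- The result of a comparison after reading one more digit `x` of the first number and the
corresponding digit of the second number, if there is one; `f` is the result so far. -/
def compareStep (f : Bool) (x : γ) : Option γ → Bool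
  | none => false
  | some y => decide (x < y) || (decide (x = y) && f)

/-- Compare the numbers on the stacks `X` and `Y`, least significant digit on top; the result, which
tells whether the first one is less, is pushed on the stack `F`. -/
noncomputable def compare (X Y F : K) (key : G → γ) (eb : Bool → G) (db : G → Bool) :
    OProg K O α β :=
  (Prog.push (.work F) (eb false)).seq
    ((Prog.loop (.work X) fun x : G => Prog.case (.work Y) fun y : Option G =>
        Prog.case (.work F) fun f : Option G =>
          Prog.push (.work F) (eb (compareStep ((f.map db).getD false) (key x) (y.map key)))).seq
      (Prog.loop (.work Y) fun _ : G => Prog.case (.work F) fun _ : Option G =>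
        Prog.push (.work F) (eb true)))

/-- The verdict on the digits already read counts only if the remaining, more significant digits
agree; it is the loop invariant of the comparison. -/
theorem rval_compareStep (f : Bool) (x : γ) (l m : List γ) :
    (rval (x :: l) < rval m ∨ rval (x :: l) = rval m ∧ f = true) ↔
      (rval l < rval m.tail ∨ rval l = rval m.tail ∧ compareStep f x m.head? = true) := by
  cases m with
  | nil => simp [rval, compareStep]
  | cons y m =>
    have h₁ := add_mul_lt_add_mul_iff (u := rval l) (v := rval m) (idx_lt_card x) (idx_lt_card y)
    have h₂ : rval (x :: l) = rval (y :: m) ↔ x = y ∧ rval l = rval m := by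
      rw [rval_injective.eq_iff, rval_injective.eq_iff, List.cons.injEq]
    rw [h₂, rval_cons, rval_cons, h₁, idx_lt_idx]
    simp only [compareStep, List.tail_cons, List.head?_cons, Bool.or_eq_true, decide_eq_true_eq,
      Bool.and_eq_true]
    tauto

theorem wRuns_compare {X Y F : K} (h₁ : X ≠ Y) (h₂ : X ≠ F) (h₃ : Y ≠ F) {key : G → γ}
    {eb : Bool → G} {db : G → Bool} (hb : ∀ b, db (eb b) = b) {S S' : K → List G}
    (hF : S F = []) {l m : List G} (hX : S X = l) (hY : S Y = m)
    (h : Function.update (Function.update (Function.update S X []) Y []) F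
      [eb (decide (rval (l.map key) < rval (m.map key)))] = S') :
    WRuns (compare X Y F key eb db : OProg K O α β) S S' (4 * l.length + 3 * m.length + 3) := by
  let st : List G → List G → Bool → K → List G := fun l m b =>
    Function.update (Function.update (Function.update S X l) Y m) F [eb b]
  have stX : ∀ l m b, st l m b X = l := fun l m b => by simp [st, h₁, h₂]
  have stY : ∀ l m b, st l m b Y = m := fun l m b => by simp [st, h₃]
  have stF : ∀ l m b, st l m b F = [eb b] := fun l m b => by simp [st]
  have upX : ∀ l m b l', Function.update (st l m b) X l' = st l' m b := fun l m b l' => by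
    funext i
    by_cases i₁ : i = X
    · subst i₁; simp [st, h₁, h₂]
    · by_cases i₂ : i = F
      · subst i₂; simp [st, i₁]
      · by_cases i₃ : i = Y
        · subst i₃; simp [st, i₁, i₂]
        · simp [st, i₁, i₂, i₃]
  have upY : ∀ l m b m', Function.update (st l m b) Y m' = st l m' b := fun l m b m' => by
    funext i
    by_cases i₁ : i = Y
    · subst i₁; simp [st, h₃]
    · by_cases i₂ : i = F
      · subst i₂; simp [st, i₁]
      · simp [st, i₁, i₂]
  have upF : ∀ l m b b', Function.update (Function.update (st l m b) F []) F [eb b'] = st l m b' :=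
    fun l m b b' => by simp [st]
  have loopX : ∀ l m b, ∃ m' b', m'.length ≤ m.length ∧
      ((rval (l.map key) < rval (m.map key) ∨ rval (l.map key) = rval (m.map key) ∧ b = true) ↔
        (0 < rval (m'.map key) ∨ 0 = rval (m'.map key) ∧ b' = true)) ∧
      WRuns (Prog.loop (.work X) fun x : G => Prog.case (.work Y) fun y : Option G =>
        Prog.case (.work F) fun f : Option G =>
          Prog.push (.work F) (eb (compareStep ((f.map db).getD false) (key x) (y.map key))) :
          OProg K O α β) (st l m b) (st [] m' b') (4 * l.length + 1) := by
    intro l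
    induction l with
    | nil => exact fun m b => ⟨m, b, le_rfl, by simp [rval], wRuns_loop_nil (stX _ _ _)⟩
    | cons x l ih =>
      intro m b
      obtain ⟨m', b', hm, e, hr⟩ := ih m.tail (compareStep b (key x) (m.head?.map key))
      refine ⟨m', b', hm.trans (by simp), ?_, ?_⟩
      · rw [← e, List.map_cons, rval_compareStep, List.map_tail, List.head?_map]
      · refine (WRuns.loop_cons (stX _ _ _) (upX _ _ _ _) (WRuns.case (o := m.head?) (by rw [stY])
          (by rw [stY, upY]) (WRuns.case (o := some (eb b)) (by rw [stF]; rfl) rfl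
            (wRuns_push (S' := st l m.tail (compareStep b (key x) (m.head?.map key))) ?_)))
          hr).of_eq rfl (by simp; omega)
        rw [stF, Function.update_self]
        simp only [Option.map_some, hb, Option.getD_some, List.tail_cons, upF]
  -- Once X is exhausted its remaining value is 0, so any digit left on Y makes the second number
  -- larger.
  have loopY : ∀ m b, WRuns (Prog.loop (.work Y) fun _ : G => Prog.case (.work F)
        fun _ : Option G => Prog.push (.work F) (eb true) : OProg K O α β) (st [] m b)
      (st [] [] (decide (0 < rval (m.map key) ∨ 0 = rval (m.map key) ∧ b = true)))
      (3 * m.length + 1) := by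
    intro m
    induction m with
    | nil => intro b; exact (wRuns_loop_nil (stY _ _ _)).of_eq (by simp [rval]) (by simp)
    | cons y m ih =>
      intro b
      refine (WRuns.loop_cons (stY _ _ _) (upY _ _ _ _) (WRuns.case (o := some (eb b))
        (by rw [stF]; rfl) rfl (wRuns_push (S' := st [] m true) ?_)) (ih true)).of_eq ?_
        (by simp; omega)
      · rw [stF, Function.update_self]
        simp only [List.tail_cons, upF]
      · congr 1
        simp only [List.map_cons, rval_cons]
        rw [decide_eq_decide]
        simp
        omega
  obtain ⟨m', b', hm, e, hr⟩ := loopX l m false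
  refine ((wRuns_push (S' := st l m false) ?_).seq (hr.seq (loopY m' b'))).of_eq ?_ ?_
  · funext i
    by_cases i₁ : i = F
    · subst i₁; simp [st, hF]
    · by_cases i₂ : i = Y
      · subst i₂; simp [st, i₁, hY]
      · by_cases i₃ : i = X
        · subst i₃; simp [st, i₁, i₂, hX]
        · simp [st, i₁, i₂, i₃]
  · rw [← h]
    simp only [st]
    congr 3
    rw [decide_eq_decide, ← e]
    simp
  · omega

end Subroutines

/-! ### Comparing the values of a function on a pair -/

theorem polyTimeOn_pair {α : Type} [Fintype α] [LinearOrder α] [Nontrivial α] {A : Set (List α)}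
    {f : List α → List α} (hf : PolyTimeOn A f) {d : List (Option α) → List Bool}
    (hd : ∀ x ∈ A, ∀ y ∈ A, d (pairStr x y) = [decide (val (f x) < val (f y))]) :
    PolyTimeOn {w | ∃ x ∈ A, ∃ y ∈ A, w = pairStr x y} d := by
  obtain ⟨a₀⟩ : Nonempty α := inferInstance
  obtain ⟨qf, hqf⟩ := hf.exists_length_le
  let ea : α → Option α × Bool := fun a => (some a, false)
  let key : Option α × Bool → α := fun g => g.1.getD a₀
  let eb : Bool → Option α × Bool := fun b => (none, b)
  let db : Option α × Bool → Bool := fun g => g.2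
  obtain ⟨o, q, hq⟩ := hf.exists_oracle key ea
  let O : Unit → Oracle (Option α × Bool) := fun _ => o
  -- The letters of y lie above the separator and those of x below it. At the separator the whole
  -- rest of stack 0 is moved away at once, which also ends the loop.
  let body : Option α × Bool → OProg (Fin 4) O (Option α) Bool := fun g =>
    if g.1.isSome then Prog.push (.work 1) g else Prog.move (.work 0) (.work 2) id
  let P : OProg (Fin 4) O (Option α) Bool := (Prog.loop (.work 0) body).seq
    ((Prog.move (.work 1) (.work 3) id).seq ((Prog.move (.work 2) (.work 0) id).seq
      ((call () 0).seq ((call () 3).seq (compare 0 3 1 key eb db)))))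
  have split : ∀ (y : List α) (r acc : List (Option α × Bool)),
      WRuns (Prog.loop (.work 0) body : OProg (Fin 4) O (Option α) Bool)
        ![y.map ea ++ eb false :: r, acc, [], []]
        ![[], (y.map ea).reverse ++ acc, r.reverse, []] (2 * y.length + 2 * r.length + 3) := by
    intro y
    induction y with
    | nil =>
      intro r acc
      have hb : WRuns (body (eb false)) ![r, acc, [], []] ![[], acc, r.reverse, []]
          (2 * r.length + 1) := by
        simp only [body, eb, Option.isSome_none, Bool.false_eq_true, if_false]
        refine wRuns_move (by decide) ?_
        funext i; fin_cases i <;> simp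
      refine (WRuns.loop_cons (g := eb false) (l := r) (S₁ := ![r, acc, [], []]) rfl ?_ hb
        (wRuns_loop_nil rfl)).of_eq rfl ?_
      · funext i; fin_cases i <;> rfl
      · simp
        omega
    | cons a y ih =>
      intro r acc
      have hb : WRuns (body (ea a)) ![y.map ea ++ eb false :: r, acc, [], []]
          ![y.map ea ++ eb false :: r, ea a :: acc, [], []] 1 := by
        simp only [body, ea, Option.isSome_some, if_true]
        refine wRuns_push ?_
        funext i; fin_cases i <;> rfl
      refine (WRuns.loop_cons (g := ea a) (l := y.map ea ++ eb false :: r)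
        (S₁ := ![y.map ea ++ eb false :: r, acc, [], []]) rfl ?_ hb (ih r (ea a :: acc))).of_eq ?_ ?_
      · funext i; fin_cases i <;> rfl
      · simp
      · simp
        omega
  refine polyTimeOn_of_wRuns P 0 1 (fun a => (a, false)) db
    (10 * Polynomial.X + 10 + 2 * q + 7 * qf) (fun w hw => ?_)
  obtain ⟨x, hx, y, hy, rfl⟩ := hw
  have hkey : key ∘ ea = id := by funext a; rfl
  refine ⟨[eb (decide (val (f x) < val (f y)))], ?_, by rw [hd x hx y hy]; rfl,
    by rw [hd x hx y hy]; simp; omega⟩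
  have cx := hq (x.map ea).reverse (by simpa [hkey, List.map_reverse] using hx)
  have cy := hq (y.map ea).reverse (by simpa [hkey, List.map_reverse] using hy)
  simp only [List.map_reverse, List.map_map, hkey, List.map_id, List.reverse_reverse,
    List.length_reverse, List.length_map] at cx cy
  have hxn : x.length ≤ (pairStr x y).length := by simp [pairStr]
  have hyn : y.length ≤ (pairStr x y).length := by simp [pairStr]; omega
  have hn : (pairStr x y).length = x.length + y.length + 1 := by simp [pairStr]; omega
  have e : ((pairStr x y).map fun a => (a, false)).reverse =
      y.reverse.map ea ++ eb false :: x.reverse.map ea := by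
    simp [pairStr, ea, eb, Function.comp_def, List.map_reverse]
  have s₁ := split y.reverse (x.reverse.map ea) []
  have s₂ : WRuns (Prog.move (.work 1) (.work 3) id : OProg (Fin 4) O (Option α) Bool)
      ![[], y.map ea, x.map ea, []] ![[], [], x.map ea, (y.map ea).reverse] _ :=
    wRuns_move (by decide) (by funext i; fin_cases i <;> simp)
  have s₃ : WRuns (Prog.move (.work 2) (.work 0) id : OProg (Fin 4) O (Option α) Bool)
      ![[], [], x.map ea, (y.map ea).reverse] ![(x.map ea).reverse, [], [], (y.map ea).reverse] _ :=
    wRuns_move (by decide) (by funext i; fin_cases i <;> simp)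
  have s₄ : WRuns (call () 0 : OProg (Fin 4) O (Option α) Bool)
      ![(x.map ea).reverse, [], [], (y.map ea).reverse]
      ![((f x).map ea).reverse, [], [], (y.map ea).reverse] _ :=
    wRuns_call cx (by funext i; fin_cases i <;> rfl)
  have s₅ : WRuns (call () 3 : OProg (Fin 4) O (Option α) Bool)
      ![((f x).map ea).reverse, [], [], (y.map ea).reverse]
      ![((f x).map ea).reverse, [], [], ((f y).map ea).reverse] _ :=
    wRuns_call cy (by funext i; fin_cases i <;> rfl)
  have s₆ : WRuns (compare 0 3 1 key eb db : OProg (Fin 4) O (Option α) Bool)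
      ![((f x).map ea).reverse, [], [], ((f y).map ea).reverse]
      ![[], [eb (decide (val (f x) < val (f y)))], [], []] _ :=
    wRuns_compare (l := ((f x).map ea).reverse) (m := ((f y).map ea).reverse) (by decide)
      (by decide) (by decide) (fun _ => rfl) rfl rfl rfl (by
      simp only [List.map_reverse, List.map_map, hkey, List.map_id]
      funext i; fin_cases i <;> rfl)
  rw [e, show Function.update (fun _ => []) (0 : Fin 4)
    (y.reverse.map ea ++ eb false :: x.reverse.map ea) =
      ![y.reverse.map ea ++ eb false :: x.reverse.map ea, [], [], []] by
    funext i; fin_cases i <;> rfl]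
  simp only [List.map_reverse, List.reverse_reverse, List.append_nil] at s₁ ⊢
  refine (s₁.seq (s₂.seq (s₃.seq (s₄.seq (s₅.seq s₆))))).of_eq ?_ ?_
  · funext i; fin_cases i <;> rfl
  · have hfx : (f x).length ≤ qf.eval (pairStr x y).length := (hqf x hx).trans (eval_mono qf hxn)
    have hfy : (f y).length ≤ qf.eval (pairStr x y).length := (hqf y hy).trans (eval_mono qf hyn)
    have hqx : q.eval x.length ≤ q.eval (pairStr x y).length := eval_mono q hxn
    have hqy : q.eval y.length ≤ q.eval (pairStr x y).length := eval_mono q hyn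
    simp
    omega

/-! ### Inverting a monotone function by prefix search -/

section Search

variable {β : Type} [Fintype β] [LinearOrder β]

theorem val_append_cons_lt (p : List β) {x y : List β} (h : x.length = y.length) {a b : β}
    (hab : a < b) : val (p ++ a :: x) < val (p ++ b :: y) := by
  rw [← lexLT_iff_val_lt]
  exact List.Shortlex.append_left (List.Shortlex.of_lex (by simp [h]) (List.Lex.rel hab)) p

theorem val_append_le (p : List β) {x y : List β} (h : val x ≤ val y) :
    val (p ++ x) ≤ val (p ++ y) := by
  rcases h.eq_or_lt with h | h
  · rw [val_injective h]
  · rw [← lexLT_iff_val_lt] at h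
    exact (lexLT_iff_val_lt.mp (List.Shortlex.append_left h p)).le

theorem val_lt_of_length_lt {x y : List β} (h : x.length < y.length) : val x < val y :=
  lexLT_iff_val_lt.mp (List.Shortlex.of_length_lt h)

theorem rval_le_of_forall_le {a : β} (ha : ∀ b, b ≤ a) (l : List β) :
    rval l ≤ rval (List.replicate l.length a) := by
  induction l with
  | nil => rfl
  | cons b l ih =>
    have h₁ : idx b ≤ idx a := by
      rcases (ha b).eq_or_lt with h | h
      · rw [h]
      · exact (idx_lt_idx.mpr h).le
    have h₂ := Nat.mul_le_mul_left (Fintype.card β) ih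
    rw [List.length_cons, List.replicate_succ, rval_cons, rval_cons]
    omega

theorem val_le_val_replicate {a : β} (ha : ∀ b, b ≤ a) {x : List β} {n : ℕ} (h : x.length ≤ n) :
    val x ≤ val (List.replicate n a) := by
  rcases h.eq_or_lt with rfl | h
  · simpa [val] using rval_le_of_forall_le ha x.reverse
  · exact (val_lt_of_length_lt (by simpa using h)).le

/-- By `hrg`, g z is the least w whose value under r is at least z, so w < g z is tested by one
evaluation of r. Writing ⊤ for the largest letter, ⊤ⁿ < g z iff n < |g z|, which yields the length.
Then the letters are found from left to right: after a correct prefix p, the next one is the first b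
for which p b ⊤…⊤ is not below g z. The bound `hg` makes the number of tests polynomial. -/
theorem polyTimeOn_search [Nonempty β] {r g : List β → List β} (hr : PolyTimeOn Set.univ r)
    (qg : Polynomial ℕ) (hg : ∀ z, (g z).length ≤ qg.eval z.length)
    (hrg : ∀ z w, val z ≤ val (r w) ↔ val (g z) ≤ val w) : PolyTimeOn Set.univ g := by
  obtain ⟨top, htop⟩ : ∃ a : β, ∀ b, b ≤ a := Finite.exists_max id
  obtain ⟨qr, hqr⟩ := hr.exists_length_le
  let el : β → β × Bool := fun a => (a, false)
  let key : β × Bool → β := fun g => g.1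
  let eb : Bool → β × Bool := fun b => (top, b)
  let db : β × Bool → Bool := fun g => g.2
  have hkey : key ∘ el = id := rfl
  obtain ⟨o, q, hq⟩ := hr.exists_oracle key el
  let O : Unit → Oracle (β × Bool) := fun _ => o
  -- Stack 0 keeps z, 1 the prefix found, 2 one padding letter ⊤ per open position. Stack 3 receives
  -- the candidate and then its image under r, 4 a copy of z, 6 the verdict; 5 is scratch space for
  -- copying.
  let test : OProg (Fin 7) O β β := (copy 2 3 5).seq ((call () 3).seq ((copy 0 4 5).seq
    (compare 3 4 6 key eb db)))
  -- A positive verdict means that the candidate is still below g z, so the next larger letter is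
  -- tried; the first negative one fixes the letter. The final `Prog.skip` is never reached.
  let try_ : List β → OProg (Fin 7) O β β := fun l => l.foldr (fun a P => (copy 1 3 5).seq
    ((Prog.push (.work 3) (el a)).seq (test.seq (Prog.case (.work 6) fun o : Option (β × Bool) =>
      if (o.map db).getD false = true then P else Prog.push (.work 1) (el a))))) Prog.skip
  let letters : List β := Finset.univ.sort (· ≤ ·)
  -- The verdict drives its own loop: a positive one leads to a longer padding and a new verdict, a
  -- negative one leaves stack 6 empty.
  let grow : β × Bool → OProg (Fin 7) O β β := fun g =>
    if db g = true then (Prog.push (.work 2) (el top)).seq test else Prog.skip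
  -- The loop on stack 2 pops one padding letter per round, opening exactly the position that is
  -- determined next.
  let P : OProg (Fin 7) O β β := test.seq ((Prog.loop (.work 6) grow).seq
    ((Prog.loop (.work 2) fun _ : β × Bool => try_ letters).seq
      (Prog.loop (.work 0) fun _ : β × Bool => Prog.skip)))
  let T : ℕ → ℕ → ℕ := fun n m => 5 * n + q.eval n + 8 * m + 4 * qr.eval n + 7
  have run_test : ∀ (z w : List β) (n : ℕ) (p R X : List (β × Bool)), w.length ≤ n →
      R ++ X = (w.map el).reverse →
      WRuns test ![(z.map el).reverse, p, R, X, [], [], []]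
        ![(z.map el).reverse, p, R, [], [], [], [eb (decide (val w < val (g z)))]]
        (T n z.length) := by
    intro z w n p R X hw hX
    have c := hq (w.map el).reverse (Set.mem_univ _)
    simp only [List.map_reverse, List.map_map, hkey, List.map_id, List.reverse_reverse,
      List.length_reverse, List.length_map] at c
    have s₁ : WRuns (copy 2 3 5 : OProg (Fin 7) O β β)
        ![(z.map el).reverse, p, R, X, [], [], []]
        ![(z.map el).reverse, p, R, (w.map el).reverse, [], [], []] _ :=
      wRuns_copy (by decide) (by decide) (by decide) rfl (by
        rw [← hX]; funext i; fin_cases i <;> rfl)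
    have s₂ : WRuns (call () 3 : OProg (Fin 7) O β β)
        ![(z.map el).reverse, p, R, (w.map el).reverse, [], [], []]
        ![(z.map el).reverse, p, R, ((r w).map el).reverse, [], [], []] _ :=
      wRuns_call c (by funext i; fin_cases i <;> rfl)
    have s₃ : WRuns (copy 0 4 5 : OProg (Fin 7) O β β)
        ![(z.map el).reverse, p, R, ((r w).map el).reverse, [], [], []]
        ![(z.map el).reverse, p, R, ((r w).map el).reverse, (z.map el).reverse, [], []] _ :=
      wRuns_copy (by decide) (by decide) (by decide) rfl (by
        funext i; fin_cases i <;> simp)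
    have s₄ : WRuns (compare 3 4 6 key eb db : OProg (Fin 7) O β β)
        ![(z.map el).reverse, p, R, ((r w).map el).reverse, (z.map el).reverse, [], []]
        ![(z.map el).reverse, p, R, [], [], [], [eb (decide (val w < val (g z)))]] _ :=
      wRuns_compare (l := ((r w).map el).reverse) (m := (z.map el).reverse)
        (by decide) (by decide) (by decide) (fun _ => rfl) rfl rfl rfl (by
          have e : val w < val (g z) ↔ rval (r w).reverse < rval z.reverse := by
            rw [← not_le, ← hrg, not_le]
            rfl
          simp only [List.map_reverse, List.map_map, hkey, List.map_id, e]
          funext i; fin_cases i <;> rfl)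
    refine (s₁.seq (s₂.seq (s₃.seq s₄))).of_eq rfl ?_
    have h₁ := congrArg List.length hX
    have h₂ : (r w).length ≤ qr.eval n := (hqr w (Set.mem_univ _)).trans (eval_mono qr hw)
    have h₃ : q.eval w.length ≤ q.eval n := eval_mono q hw
    simp [T] at h₁ ⊢
    omega
  have run_grow : ∀ (z : List β) (d n : ℕ), n + d = (g z).length →
      WRuns (Prog.loop (.work 6) grow)
        ![(z.map el).reverse, [], List.replicate n (el top), [], [], [],
          [eb (decide (n < (g z).length))]]
        ![(z.map el).reverse, [], List.replicate (g z).length (el top), [], [], [], []]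
        (d * (2 + T (g z).length z.length) + 3) := by
    intro z d
    induction d with
    | zero =>
      intro n hn
      obtain rfl : n = (g z).length := hn
      have hb : grow (eb (decide ((g z).length < (g z).length))) = Prog.skip := by
        simp [grow, eb, db]
      refine (WRuns.loop_cons (g := eb (decide ((g z).length < (g z).length))) (l := [])
        (S₁ := ![(z.map el).reverse, [], List.replicate (g z).length (el top), [], [], [], []])
        rfl ?_ (by rw [hb]; exact wRuns_skip _) (wRuns_loop_nil rfl)).of_eq rfl (by simp)
      funext i; fin_cases i <;> rfl
    | succ d ih =>
      intro n hn
      have hb : grow (eb (decide (n < (g z).length))) =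
          (Prog.push (.work 2) (el top)).seq test := by
        have : n < (g z).length := by omega
        simp [grow, eb, db, this]
      have e : val (List.replicate (n + 1) top) < val (g z) ↔ n + 1 < (g z).length := by
        constructor
        · intro h
          by_contra! hn
          exact absurd h (val_le_val_replicate htop hn).not_gt
        · intro h
          exact val_lt_of_length_lt (by simpa using h)
      have s₁ : WRuns (Prog.push (.work 2) (el top) : OProg (Fin 7) O β β)
          ![(z.map el).reverse, [], List.replicate n (el top), [], [], [], []]
          ![(z.map el).reverse, [], List.replicate (n + 1) (el top), [], [], [], []] _ :=
        wRuns_push (by funext i; fin_cases i <;> rfl)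
      have s₂ := run_test z (List.replicate (n + 1) top) (g z).length []
        (List.replicate (n + 1) (el top)) [] (by simp; omega) (by simp)
      simp only [e] at s₂
      refine (WRuns.loop_cons (g := eb (decide (n < (g z).length))) (l := [])
        (S₁ := ![(z.map el).reverse, [], List.replicate n (el top), [], [], [], []])
        rfl ?_ (by rw [hb]; exact s₁.seq s₂) (ih (n + 1) (by omega))).of_eq rfl ?_
      · funext i; fin_cases i <;> rfl
      · rw [Nat.succ_mul]
        omega
  have run_try : ∀ (z p s : List β) (a : β) (l₁ l₂ : List β), g z = p ++ a :: s →
      (∀ b ∈ l₁, b < a) →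
      WRuns (try_ (l₁ ++ a :: l₂))
        ![(z.map el).reverse, (p.map el).reverse, List.replicate s.length (el top), [], [], [], []]
        ![(z.map el).reverse, ((p ++ [a]).map el).reverse, List.replicate s.length (el top),
          [], [], [], []]
        ((l₁.length + 1) * (5 * (g z).length + T (g z).length z.length + 5)) := by
    intro z p s a l₁ l₂ hz
    have hlen : (g z).length = p.length + s.length + 1 := by rw [hz]; simp; omega
    have s₁ : WRuns (copy 1 3 5 : OProg (Fin 7) O β β)
        ![(z.map el).reverse, (p.map el).reverse, List.replicate s.length (el top), [], [], [], []]
        ![(z.map el).reverse, (p.map el).reverse, List.replicate s.length (el top),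
          (p.map el).reverse, [], [], []] _ :=
      wRuns_copy (by decide) (by decide) (by decide) rfl (by
        funext i; fin_cases i <;> simp)
    have s₂ : ∀ b, WRuns (Prog.push (.work 3) (el b) : OProg (Fin 7) O β β)
        ![(z.map el).reverse, (p.map el).reverse, List.replicate s.length (el top),
          (p.map el).reverse, [], [], []]
        ![(z.map el).reverse, (p.map el).reverse, List.replicate s.length (el top),
          el b :: (p.map el).reverse, [], [], []] _ := fun b =>
      wRuns_push (by funext i; fin_cases i <;> rfl)
    have s₃ := fun b => run_test z (p ++ b :: List.replicate s.length top) (g z).length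
      (p.map el).reverse (List.replicate s.length (el top)) (el b :: (p.map el).reverse)
      (by rw [hlen]; simp; omega) (by simp)
    induction l₁ with
    | nil =>
      intro _
      have e : ¬ val (p ++ a :: List.replicate s.length top) < val (g z) := by
        rw [hz, not_lt]
        have := val_append_le (p ++ [a]) (val_le_val_replicate htop (le_refl s.length))
        simpa using this
      have h := s₃ a
      simp only [e, decide_false] at h
      refine (s₁.seq ((s₂ a).seq (h.seq (WRuns.case (o := some (eb false))
        (S₁ := ![(z.map el).reverse, (p.map el).reverse, List.replicate s.length (el top),
          [], [], [], []]) rfl ?_ (t := 1) ?_)))).of_eq rfl ?_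
      · funext i; fin_cases i <;> rfl
      · simp only [Option.map_some, Option.getD_some, db, eb, Bool.false_eq_true, if_false]
        exact wRuns_push (by funext i; fin_cases i <;> simp)
      · simp [hlen]
        omega
    | cons b l₁ ih =>
      intro hb
      have e : val (p ++ b :: List.replicate s.length top) < val (g z) := by
        rw [hz]
        exact val_append_cons_lt p (by simp) (hb b (by simp))
      have h := s₃ b
      simp only [e, decide_true] at h
      refine (s₁.seq ((s₂ b).seq (h.seq (WRuns.case (o := some (eb true))
        (S₁ := ![(z.map el).reverse, (p.map el).reverse, List.replicate s.length (el top),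
          [], [], [], []]) rfl ?_
        (t := (l₁.length + 1) * (5 * (g z).length + T (g z).length z.length + 5))
        ?_)))).of_eq rfl ?_
      · funext i; fin_cases i <;> rfl
      · simp only [Option.map_some, Option.getD_some, db, eb, if_true]
        exact ih fun b' hb' => hb b' (by simp [hb'])
      · rw [List.length_cons, Nat.succ_mul (l₁.length + 1)]
        simp [hlen]
        omega
  have run_letters : ∀ (z s p : List β), g z = p ++ s →
      WRuns (Prog.loop (.work 2) fun _ : β × Bool => try_ letters)
        ![(z.map el).reverse, (p.map el).reverse, List.replicate s.length (el top), [], [], [], []]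
        ![(z.map el).reverse, ((g z).map el).reverse, [], [], [], [], []]
        (s.length * (1 + Fintype.card β * (5 * (g z).length + T (g z).length z.length + 5)) + 1) := by
    intro z s
    induction s with
    | nil =>
      intro p hp
      refine (wRuns_loop_nil rfl).of_eq ?_ (by simp)
      rw [hp, List.append_nil]
      rfl
    | cons a s ih =>
      intro p hp
      obtain ⟨l₁, l₂, hl⟩ := List.append_of_mem
        (show a ∈ letters from (Finset.mem_sort _).mpr (Finset.mem_univ a))
      have hlt : ∀ b ∈ l₁, b < a := by
        have : letters.Pairwise (· < ·) := Finset.sortedLT_sort _ |>.pairwise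
        rw [hl, List.pairwise_append] at this
        exact fun b hb => this.2.2 b hb a (by simp)
      have hle : l₁.length + 1 ≤ Fintype.card β := by
        have : letters.length = Fintype.card β := Finset.length_sort _
        rw [hl] at this
        simp at this
        omega
      refine (WRuns.loop_cons (g := el top) (l := List.replicate s.length (el top))
        (S₁ := ![(z.map el).reverse, (p.map el).reverse, List.replicate s.length (el top),
          [], [], [], []]) rfl ?_ (by rw [hl]; exact run_try z p s a l₁ l₂ hp hlt)
        (ih (p ++ [a]) (by simpa using hp))).of_eq rfl ?_
      · funext i; fin_cases i <;> rfl
      · have := Nat.mul_le_mul_right (5 * (g z).length + T (g z).length z.length + 5) hle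
        rw [List.length_cons, Nat.succ_mul s.length]
        omega
  have run_clear : ∀ (z p : List (β × Bool)),
      WRuns (Prog.loop (.work 0) fun _ : β × Bool => Prog.skip : OProg (Fin 7) O β β)
        ![z, p, [], [], [], [], []] ![[], p, [], [], [], [], []] (2 * z.length + 1) := by
    intro z p
    induction z with
    | nil => exact (wRuns_loop_nil rfl).of_eq rfl (by simp)
    | cons a z ih =>
      refine (WRuns.loop_cons (g := a) (l := z) (S₁ := ![z, p, [], [], [], [], []]) rfl ?_
        (wRuns_skip _) ih).of_eq rfl (by simp; omega)
      funext i; fin_cases i <;> rfl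
  let pT : Polynomial ℕ := 5 * qg + q.comp qg + 8 * Polynomial.X + 4 * qr.comp qg + 7
  refine polyTimeOn_of_wRuns P 0 1 el key
    (pT + qg * (2 + pT) + qg * (1 + Polynomial.C (Fintype.card β) * (5 * qg + pT + 5)) +
      2 * Polynomial.X + qg + 10) (fun z _ => ⟨((g z).map el).reverse, ?_, ?_, ?_⟩)
  · have hT : T (g z).length z.length ≤ pT.eval z.length := by
      have h₁ := hg z
      have h₂ : q.eval (g z).length ≤ q.eval (qg.eval z.length) := eval_mono q h₁
      have h₃ : qr.eval (g z).length ≤ qr.eval (qg.eval z.length) := eval_mono qr h₁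
      simp [T, pT]
      omega
    have e : val ([] : List β) < val (g z) ↔ 0 < (g z).length := by
      constructor
      · intro h
        by_contra! hn
        exact absurd h (val_le_val_replicate htop hn).not_gt
      · intro h
        exact val_lt_of_length_lt (by simpa using h)
    have s₁ := run_test z [] (g z).length [] [] [] (by simp) rfl
    simp only [e] at s₁
    have s₂ := run_grow z (g z).length 0 (by simp)
    have s₃ := run_letters z (g z) [] rfl
    have s₄ := run_clear (z.map el).reverse ((g z).map el).reverse
    rw [show Function.update (fun _ => []) (0 : Fin 7) (z.map el).reverse =
      ![(z.map el).reverse, [], [], [], [], [], []] by funext i; fin_cases i <;> rfl]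
    refine (s₁.seq (s₂.seq (s₃.seq s₄))).of_eq (by funext i; fin_cases i <;> rfl) ?_
    have h₁ : (g z).length * (2 + T (g z).length z.length) ≤
        qg.eval z.length * (2 + pT.eval z.length) := by
      have := hg z
      gcongr
    have h₂ : (g z).length * (1 + Fintype.card β * (5 * (g z).length +
        T (g z).length z.length + 5)) ≤ qg.eval z.length * (1 + Fintype.card β *
          (5 * qg.eval z.length + pT.eval z.length + 5)) := by
      have := hg z
      gcongr
    simp only [List.length_reverse, List.length_map, Polynomial.eval_add, Polynomial.eval_mul,
      Polynomial.eval_C, Polynomial.eval_X, Polynomial.eval_ofNat, Polynomial.eval_one]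
    omega
  · simp [key, el, Function.comp_def]
  · have := hg z
    simp only [Polynomial.eval_add]
    omega

end Search

/-! ### Density -/

section Density

variable {α : Type}

/-- This form of density says that every index written with m digits in base b is reached among the
strings of L of length at most Q(m). -/
theorem ExponentiallyDense.exists_pow_le_census {L : Language α} (hL : ExponentiallyDense L)
    (b : ℕ) : ∃ Q : Polynomial ℕ, ∀ m : ℕ, b ^ (m + 1) ≤ census L (Q.eval m) := by
  obtain ⟨c, hc, a, ha, h⟩ := hL
  obtain ⟨n₀, hn₀⟩ := Filter.eventually_atTop.mp h
  -- The power k ≥ 1/c undoes the exponent c, and D ≥ b/a undoes the factor a: for n ≥ (D(m+1))^k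
  -- one gets a·n^c ≥ b(m+1), and 2^(b(m+1)) ≥ b^(m+1).
  obtain ⟨k, hk⟩ := exists_nat_ge (1 / c)
  obtain ⟨D, hD⟩ := exists_nat_ge (max 1 (b / a))
  have hD₁ : (1 : ℝ) ≤ D := (le_max_left _ _).trans hD
  have hD₂ : (b : ℝ) ≤ a * D := by
    have := (le_max_right _ _).trans hD
    rw [div_le_iff₀ ha] at this
    linarith
  have hkc : 1 ≤ (k : ℝ) * c := by rwa [div_le_iff₀ hc] at hk
  refine ⟨(Polynomial.C D * (Polynomial.X + 1)) ^ k + Polynomial.C n₀, fun m => ?_⟩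
  set n := ((Polynomial.C D * (Polynomial.X + 1)) ^ k + Polynomial.C n₀).eval m with hn
  have hn' : n = (D * (m + 1)) ^ k + n₀ := by simp [hn]
  have h₁ := hn₀ n (by omega)
  have h₂ : (1 : ℝ) ≤ D * (m + 1) := by nlinarith [(Nat.cast_nonneg m : (0 : ℝ) ≤ m)]
  have h₃ : (D * (m + 1) : ℝ) ≤ (n : ℝ) ^ c := by
    calc (D * (m + 1) : ℝ) = (D * (m + 1) : ℝ) ^ (1 : ℝ) := (Real.rpow_one _).symm
      _ ≤ (D * (m + 1) : ℝ) ^ (k * c : ℝ) := Real.rpow_le_rpow_of_exponent_le h₂ hkc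
      _ = ((D * (m + 1) : ℝ) ^ k) ^ c := by
        rw [Real.rpow_mul (by linarith), Real.rpow_natCast]
      _ ≤ (n : ℝ) ^ c := by
        apply Real.rpow_le_rpow (by positivity) _ hc.le
        rw [hn']
        push_cast
        linarith [(Nat.cast_nonneg n₀ : (0 : ℝ) ≤ n₀)]
  have h₄ : (b * (m + 1) : ℝ) ≤ a * (n : ℝ) ^ c := by
    have := mul_le_mul_of_nonneg_left h₃ ha.le
    nlinarith [(Nat.cast_nonneg m : (0 : ℝ) ≤ m)]
  have h₅ : ((b ^ (m + 1) : ℕ) : ℝ) ≤ (2 : ℝ) ^ (a * (n : ℝ) ^ c) := by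
    have h₆ : b ^ (m + 1) ≤ 2 ^ (b * (m + 1)) := by
      rw [pow_mul]
      exact Nat.pow_le_pow_left Nat.lt_two_pow_self.le _
    calc ((b ^ (m + 1) : ℕ) : ℝ) ≤ ((2 ^ (b * (m + 1)) : ℕ) : ℝ) := by exact_mod_cast h₆
      _ = (2 : ℝ) ^ (b * (m + 1) : ℝ) := by
        push_cast
        rw [← Real.rpow_natCast]
        push_cast
        rfl
      _ ≤ _ := Real.rpow_le_rpow_of_exponent_le one_le_two h₄
  exact_mod_cast h₅.trans h₁

theorem ExponentiallyDense.infinite {L : Language α} (hL : ExponentiallyDense L) :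
    {x | x ∈ L}.Infinite := by
  intro hfin
  obtain ⟨Q, hQ⟩ := hL.exists_pow_le_census 2
  have h₁ := hQ {x | x ∈ L}.ncard
  have h₂ : census L (Q.eval {x | x ∈ L}.ncard) ≤ {x | x ∈ L}.ncard :=
    Set.ncard_le_ncard (fun x hx => hx.1) hfin
  have h₃ : {x | x ∈ L}.ncard + 1 < 2 ^ ({x | x ∈ L}.ncard + 1) := Nat.lt_two_pow_self
  omega

end Density

/-! ### The three implications -/

section Main

variable {α : Type}

theorem StronglyPRankable.pScalable [Fintype α] [LinearOrder α] [Nontrivial α]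
    {L : Language α} (h : StronglyPRankable L) : PScalable L :=
  ⟨α, inferInstance, inferInstance, inferInstance, L, h, Equiv.refl _, polyTimeOn_id,
    polyTimeOn_id, fun _ => Iff.rfl⟩

/-- If the k-th element of B were longer than q(n), the images of all strings of L of length at most
n would precede it, and these are more than k distinct elements of B. -/
theorem length_str_nth_le {β : Type} [Fintype β] [LinearOrder β] [Nontrivial β] {L : Language α}
    {B : Language β} (e : List α ≃ List β) (he : ∀ x, x ∈ L ↔ e x ∈ B) {q : Polynomial ℕ}
    (hq : ∀ x, (e x).length ≤ q.eval x.length) (hB : {n | str β n ∈ B}.Infinite) {k n : ℕ}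
    (hk : k < census L n) : (str β (Nat.nth (fun n => str β n ∈ B) k)).length ≤ q.eval n := by
  classical
  by_contra! hlt
  have h₁ : Set.MapsTo (fun x => val (e x)) {x | x ∈ L ∧ x.length ≤ n}
      ((Finset.range (Nat.nth (fun n => str β n ∈ B) k)).filter (fun n => str β n ∈ B) : Set ℕ) := by
    rintro x ⟨hx, hxn⟩
    simp only [Finset.coe_filter, Finset.mem_range, Set.mem_ofPred_eq, str_val]
    refine ⟨?_, (he x).mp hx⟩
    have := val_lt_of_length_lt (((hq x).trans (eval_mono q hxn)).trans_lt hlt)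
    rwa [val_str] at this
  have h₂ := Set.ncard_le_ncard_of_injOn _ h₁
    (fun x _ y _ h => e.injective (val_injective h)) (Finset.finite_toSet _)
  rw [Set.ncard_coe_finset, ← Nat.count_eq_card_filter_range, Nat.count_nth_of_infinite hB] at h₂
  rw [census] at hk
  omega

theorem PScalable.pCountable [Fintype α] [LinearOrder α] [Nontrivial α]
    {L : Language α} (hL : ExponentiallyDense L) (h : PScalable L) :
    PCountable L := by
  classical
  obtain ⟨β, _, _, _, B, ⟨r, hr, hrank⟩, e, he, hes, heB⟩ := h
  right
  let p : ℕ → Prop := fun n => str β n ∈ B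
  have hp : {n | p n}.Infinite := by
    refine Set.infinite_of_injOn_mapsTo (f := fun x => val (e x))
      (fun x _ y _ h => e.injective (val_injective h)) (fun x hx => ?_) hL.infinite
    show str β (val (e x)) ∈ B
    rw [str_val]
    exact (heB x).mp hx
  have hr' : ∀ w, val (r w) = Nat.count p (val w + 1) := fun w => by
    rw [← numOfStr_eq_val, hrank, rank_eq_count]
  obtain ⟨q, hq⟩ := he.exists_length_le
  obtain ⟨Q, hQ⟩ := hL.exists_pow_le_census (Fintype.card β)
  -- The element of index k, counted from 0, has rank k + 1. The value [] at 0 makes the equivalence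
  -- required by the search hold for every z.
  let s : List β → List β := fun z => if val z = 0 then [] else str β (Nat.nth p (val z - 1))
  have hs : PolyTimeOn Set.univ s := by
    refine polyTimeOn_search hr (q.comp Q) (fun z => ?_) (fun z w => ?_)
    · by_cases hz : val z = 0
      · simp [s, hz]
      · simp only [s, hz, if_false, Polynomial.eval_comp]
        refine length_str_nth_le e heB (fun x => hq x (Set.mem_univ _)) hp ?_
        have := val_lt_pow z
        have := hQ z.length
        omega
    · rw [hr']
      by_cases hz : val z = 0
      · have h₀ : val ([] : List β) = 0 := rfl
        rw [show s z = [] from if_pos hz, hz, h₀]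
        simp
      · simp only [s, hz, if_false, val_str]
        have : Nat.count p (val w + 1) ≤ val z - 1 ↔ val w + 1 ≤ Nat.nth p (val z - 1) :=
          Nat.count_le_iff_le_nth hp
        omega
  -- Both maps pass through the numbers, since the alphabets may differ: x goes to rank(e x) − 1,
  -- and y to the preimage of the element of rank y + 1.
  have hf := (polyTimeOn_convert (α := β) (β := α)).comp (polyTimeOn_pred.comp
    (hr.comp he (Set.mapsTo_univ _ _)) (Set.mapsTo_univ _ _)) (Set.mapsTo_univ _ _)
  have hg := hes.comp (hs.comp (polyTimeOn_succ.comp (polyTimeOn_convert (α := α) (β := β))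
    (Set.mapsTo_univ _ _)) (Set.mapsTo_univ _ _)) (Set.mapsTo_univ _ _)
  have hsy : ∀ y : List α, s (str β (val (str β (val y)) + 1)) = str β (Nat.nth p (val y)) := by
    intro y
    simp [s, val_str]
  refine ⟨_, _, hf.mono (Set.subset_univ _), hg.mono (Set.subset_univ _), fun _ _ => trivial,
    fun y _ => ?_, fun x hx => ?_, fun y _ => ?_⟩
  · rw [heB, Equiv.apply_symm_apply, hsy]
    exact Nat.nth_mem_of_infinite hp _
  · have hpx : p (val (e x)) := by
      show str β (val (e x)) ∈ B
      rw [str_val]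
      exact (heB x).mp hx
    rw [hsy, val_str, val_str, hr', Nat.count_succ, if_pos hpx, Nat.add_sub_cancel,
      Nat.nth_count hpx, str_val, Equiv.symm_apply_apply]
  · rw [Equiv.apply_symm_apply, hsy, hr', val_str, val_str, Nat.count_nth_succ_of_infinite hp,
      Nat.add_sub_cancel, str_val]

theorem pairStr_injective {x y x' y' : List α} (h : pairStr x y = pairStr x' y') :
    x = x' ∧ y = y' := by
  induction x generalizing x' with
  | nil =>
    cases x' with
    | nil => simpa [pairStr, List.map_inj_right] using h
    | cons a x' => simp [pairStr] at h
  | cons a x ih =>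
    cases x' with
    | nil => simp [pairStr] at h
    | cons b x' =>
      simp only [pairStr, List.map_cons, List.cons_append, List.cons.injEq, Option.some.injEq] at h
      obtain ⟨rfl, rfl⟩ := ih h.2
      exact ⟨by rw [h.1], rfl⟩

/-- The order is the one of ℕ pulled back along x ↦ `val (f x)`. If x precedes y then |f x| ≤ |f y|,
and applying g gives the polynomial bound on |x|. -/
theorem PEquipollent.exists_order [Fintype α] [LinearOrder α] [Nontrivial α]
    {L : Language α} (h : PEquipollent L (⊤ : Language α)) :
    ∃ R : {x // x ∈ L} → {x // x ∈ L} → Prop,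
      IsStrictTotalOrder {x // x ∈ L} R ∧ LengthRelated L R ∧ DecidablePolyTime L R ∧
        WeaklyPRankableWrt L R := by
  classical
  obtain ⟨f, g, hf, hg, -, hgL, hgf, hfg⟩ := h
  have hinj : ∀ x y : {x // x ∈ L}, f x.1 = f y.1 → x = y := fun x y h => by
    apply Subtype.ext
    rw [← hgf x.1 x.2, h, hgf y.1 y.2]
  let R : {x // x ∈ L} → {x // x ∈ L} → Prop := fun x y => val (f x.1) < val (f y.1)
  let emb : R ↪r ((· < ·) : ℕ → ℕ → Prop) :=
    ⟨⟨fun x => val (f x.1), fun x y h => hinj x y (val_injective h)⟩, Iff.rfl⟩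
  refine ⟨R, emb.isStrictTotalOrder, ?_, ?_, ?_⟩
  · obtain ⟨qf, hqf⟩ := hf.exists_length_le
    obtain ⟨qg, hqg⟩ := hg.exists_length_le
    refine ⟨qg.comp qf, fun x y hxy => ?_⟩
    have h₁ := hqg (f x.1) trivial
    rw [hgf x.1 x.2] at h₁
    rw [Polynomial.eval_comp]
    exact h₁.trans (eval_mono qg ((length_le_of_val_le (le_of_lt hxy)).trans (hqf y.1 y.2)))
  · let d : List (Option α) → List Bool := fun w =>
      [decide (∃ x ∈ L, ∃ y ∈ L, w = pairStr x y ∧ val (f x) < val (f y))]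
    have hd : ∀ x ∈ L, ∀ y ∈ L, d (pairStr x y) = [decide (val (f x) < val (f y))] := by
      intro x hx y hy
      simp only [d, List.cons.injEq, decide_eq_decide, and_true]
      constructor
      · rintro ⟨x', -, y', -, e, h⟩
        obtain ⟨rfl, rfl⟩ := pairStr_injective e
        exact h
      · exact fun h => ⟨x, hx, y, hy, rfl, h⟩
    refine ⟨d, polyTimeOn_pair hf hd, fun x y => ?_⟩
    rw [hd x.1 x.2 y.1 y.2]
    by_cases hR : R x y
    · rw [if_pos hR]
      simpa using hR
    · rw [if_neg hR]
      simpa using not_lt.mp hR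
  · refine ⟨_, polyTimeOn_succ.comp hf (Set.mapsTo_univ _ _), fun x => ?_⟩
    have h₁ : {y : {x // x ∈ L} | y = x ∨ R y x} =
        {y : {x // x ∈ L} | val (f y.1) < val (f x.1) + 1} := by
      ext y
      simp only [Set.mem_ofPred_eq, Nat.lt_succ_iff, le_iff_eq_or_lt]
      exact or_congr_left ⟨fun h => by rw [h], fun h => hinj y x (val_injective h)⟩
    -- Surjectivity of f, through g, leaves no gaps: every number up to `val (f x)` is attained, so
    -- the rank is exactly `val (f x) + 1`.
    have h₂ : (fun y : {x // x ∈ L} => val (f y.1)) '' {y | val (f y.1) < val (f x.1) + 1} =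
        (Finset.range (val (f x.1) + 1) : Set ℕ) := by
      ext n
      constructor
      · rintro ⟨y, hy, rfl⟩
        simpa using hy
      · intro hn
        have e : val (f (g (str α n))) = n := by rw [hfg _ trivial, val_str]
        exact ⟨⟨g (str α n), hgL _ trivial⟩, by simpa [e] using hn, e⟩
    rw [numOfStr_eq_val, val_str, h₁, ← Set.InjOn.encard_image (f := fun y : {x // x ∈ L} =>
      val (f y.1)) (fun y _ z _ h => hinj y z (val_injective h)), h₂,
      Set.encard_coe_eq_coe_finsetCard, Finset.card_range]

end Main

end PCard

theorem mainTheorem9 {α : Type} [Fintype α] [LinearOrder α] [Nontrivial α]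
    (L : Language α) (hL : PCard.ExponentiallyDense L) :
    (PCard.StronglyPRankable L → PCard.PScalable L) ∧
    (PCard.PScalable L → PCard.PCountable L) ∧
    (PCard.PCountable L →
      ∃ R : {x // x ∈ L} → {x // x ∈ L} → Prop,
        IsStrictTotalOrder {x // x ∈ L} R ∧
        PCard.LengthRelated L R ∧
        PCard.DecidablePolyTime L R ∧
        PCard.WeaklyPRankableWrt L R) :=
  ⟨PCard.StronglyPRankable.pScalable, PCard.PScalable.pCountable hL, fun h =>
    (h.resolve_left hL.infinite).exists_order⟩
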